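/- Let $K\subset\mathbb R^2$ be a curvilinear polygon: a bounded, simply connected open set with Lipschitz boundary, where $\partial K$ is a finite union of smooth ($C^\infty$, regularly parametrized up to the end points) arcs with disjoint interiors, called edges. Let $n$ be the outward unit normal and $ds$ arc length on $\partial K$. For $k\in\mathbb Z$ let $\mathbb P_k$ be the real polynomials on $\mathbb R^2$ of total degree $\le k$ ($\mathbb P_k=\{0\}$ for $k<0$), and for $m\in\mathbb N$ let $\mathbb P_m^*(\partial K)$ be the continuous functions on $\partial K$ whose restriction to each edge is the restriction of an element of $\mathbb P_m$. With weak derivatives and traces, set $$V_m^{\partial K}(K)=\{v\in H^1(K):\ \Delta v=0 \text{ in } K,\ v|_{\partial K}\in\mathbb P_m^*(\partial K)\},\qquad V_m^{K}(K)=\{v\in H^1(K):\ \Delta v\in\mathbb P_{m-2}(K)\text{ in }K,\ v|_{\partial K}=0\}.$$ For $v\in H^1(K)$ with $\Delta v\in L^2(K)$, let $\partial v/\partial n\in H^{-1/2}(\partial K)$ be the normal trace of $\nabla v\in H(\mathrm{div};K)$, i.e. the extension by continuity, from $H(\mathrm{div};K)$ to the dual of the space $H^{1/2}(\partial K)$ of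 traces of $H^1(K)$ functions, of the map $F\mapsto F\cdot n$ on fields $F$ smooth up to the boundary, where $F\cdot n$ acts by $f\mapsto\int_{\partial K}(F\cdot n)f\,ds$. The integral $\int_{\partial K}\frac{\partial v}{\partial n}f\,ds$ denotes the value of $\partial v/\partial n$ at the trace $f$. Then: 1. If $v\in V_m^{\partial K}(K)$ and $w\in V_m^{K}(K)$, then $\int_K\nabla v\cdot\nabla w\,dx=0$. 2. If $v,w\in V_m^{\partial K}(K)$, then $\partial v/\partial n$ exists and $$\int_K\nabla v\cdot\nabla w\,dx=\int_{\partial K}\frac{\partial v}{\partial n}\,w\,ds .$$ 3. Let $v,w\in V_m^{K}(K)$, with $\Delta v=p$ and $\Delta w=q$ in $K$, $p,q\in\mathbb P_{m-2}$, and let $P,Q\in\mathbb P_m$ satisfy $\Delta P=p$ and $\Delta Q=q$. Then $\partial v/\partial n$ exists and $$\int_K\nabla v\cdot\nabla w\,dx=\int_{\partial K}\frac{\partial v}{\partial n}\,Q\,ds-\int_K pQ\,dx .$$ Moreover, $v-P\in V_m^{\partial K}(K)$ (in particular $v-P$ is harmonic), its trace on $\partial K$ is $-P$, the normal derivatives of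 $v-P$ and $P$ exist, and $$\frac{\partial v}{\partial n}=\frac{\partial (v-P)}{\partial n}+\frac{\partial P}{\partial n},$$ where $\partial P/\partial n$ is the classical normal derivative $\nabla P\cdot n$. In 2 and 3, whenever $\partial v/\partial n$ is represented by a function $g\in L^1(\partial K)$, meaning that its value at $\varphi|_{\partial K}$ is $\int_{\partial K}g\varphi\,ds$ for all $\varphi\in C^\infty(\mathbb R^2)$, the products $gw$ and $gQ$ are integrable on $\partial K$, and the formulas hold with the boundary integrals being the Lebesgue integrals $\int_{\partial K}g\,w\,ds$ and $\int_{\partial K}g\,Q\,ds$, respectively. -/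

import Mathlib

open MeasureTheory Set Filter Topology
open scoped ContDiff RealInnerProductSpace

/-- The Euclidean plane. -/
abbrev Plane : Type := EuclideanSpace ℝ (Fin 2)

/-- `K` has Lipschitz boundary: near each boundary point, in suitable Cartesian coordinates,
`K` is the strict epigraph of a Lipschitz function. -/
def HasLipschitzBoundary (K : Set Plane) : Prop :=
  ∀ x ∈ frontier K, ∃ (e : Plane ≃ₗᵢ[ℝ] Plane) (ψ : ℝ → ℝ) (L : NNReal) (ε : ℝ),
    LipschitzWith L ψ ∧ 0 < ε ∧ ∀ y ∈ Metric.ball x ε, y ∈ K ↔ ψ (e y 0) < e y 1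

/-- A curvilinear polygon: a bounded simply connected open set with Lipschitz boundary, together
with a decomposition of the boundary into finitely many smooth arcs with disjoint interiors
(the edges), each given by a regular parametrization over `[0, 1]`. An edge does not meet itself,
except that its two end points may coincide. -/
structure CurvilinearPolygon where
  carrier : Set Plane
  isOpen : IsOpen carrier
  isBounded : Bornology.IsBounded carrier
  simplyConnected : IsSimplyConnected carrier
  lipschitz : HasLipschitzBoundary carrier
  numEdges : ℕ
  edge : Fin numEdges → ℝ → Plane
  edge_smooth : ∀ i, ContDiffOn ℝ ∞ (edge i) (Icc 0 1)
  edge_regular : ∀ i, ∀ t ∈ Icc (0 : ℝ) 1, derivWithin (edge i) (Icc 0 1) t ≠ 0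
  edge_injOn_left : ∀ i, InjOn (edge i) (Ico 0 1)
  edge_injOn_right : ∀ i, InjOn (edge i) (Ioc 0 1)
  edge_disjoint : ∀ i j, i ≠ j → Disjoint (edge i '' Ioo 0 1) (edge j '' Ioo 0 1)
  frontier_eq : frontier carrier = ⋃ i, edge i '' Icc 0 1

/-- `ν` is the outward unit normal of `K` at `x`: to first order at `x`, the set `K` is the
half plane `⟪y - x, ν⟫ < 0`. -/
def IsOutwardUnitNormal (K : Set Plane) (x ν : Plane) : Prop :=
  ‖ν‖ = 1 ∧ ∀ ε > 0, ∀ᶠ y in 𝓝 x,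
    (y ∈ K → ⟪y - x, ν⟫ ≤ ε * ‖y - x‖) ∧ (y ∉ K → -(ε * ‖y - x‖) ≤ ⟪y - x, ν⟫)

/-- There is at most one outward unit normal at a point. -/
theorem IsOutwardUnitNormal.unique {K : Set Plane} {x ν μ : Plane}
    (hν : IsOutwardUnitNormal K x ν) (hμ : IsOutwardUnitNormal K x μ) : ν = μ := by
  by_contra hne
  set c : ℝ := ⟪ν, μ⟫ with hc
  have hlt : c < 1 := (inner_lt_one_iff_real_of_norm_eq_one hν.1 hμ.1).2 hne
  set u : Plane := μ - ν with hu
  have h1 : ⟪u, ν⟫ = c - 1 := by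
    rw [hu, inner_sub_left, real_inner_self_eq_norm_sq, hν.1, real_inner_comm]; ring
  have h2 : ⟪u, μ⟫ = 1 - c := by
    rw [hu, inner_sub_left, real_inner_self_eq_norm_sq, hμ.1]; ring
  set ε : ℝ := (1 - c) / (‖u‖ + 1) with hε
  have hpos : 0 < ε := div_pos (by linarith) (by positivity)
  have hsmall : ε * ‖u‖ < 1 - c := by
    have h3 : ε * (‖u‖ + 1) = 1 - c := div_mul_cancel₀ _ (by positivity)
    nlinarith
  have hev := (hν.2 ε hpos).and (hμ.2 ε hpos)
  have htend : Tendsto (fun s : ℝ => x + s • u) (𝓝[>] 0) (𝓝 x) := by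
    have h4 : Tendsto (fun s : ℝ => x + s • u) (𝓝 0) (𝓝 (x + (0 : ℝ) • u)) :=
      Continuous.tendsto (by fun_prop) 0
    rw [zero_smul, add_zero] at h4
    exact h4.mono_left nhdsWithin_le_nhds
  obtain ⟨s, ⟨hs1, hs2⟩, hs⟩ := ((htend.eventually hev).and self_mem_nhdsWithin).exists
  have hs : 0 < s := hs
  simp only [add_sub_cancel_left, inner_smul_left, norm_smul, Real.norm_eq_abs, abs_of_pos hs,
    h1, h2, conj_trivial] at hs1 hs2
  have h5 : s * (ε * ‖u‖) < s * (1 - c) := mul_lt_mul_of_pos_left hsmall hs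
  by_cases hK : x + s • u ∈ K
  · have := hs2.1 hK
    nlinarith
  · have := hs1.2 hK
    nlinarith

open Classical in
/-- The outward unit normal (with value `0` at the points, such as corners, without a normal). -/
noncomputable def outwardNormal (K : Set Plane) (x : Plane) : Plane :=
  if h : ∃ ν, IsOutwardUnitNormal K x ν then h.choose else 0

/-- The arc length measure `ds` on the boundary of `K`. -/
noncomputable def CurvilinearPolygon.ds (K : CurvilinearPolygon) : Measure Plane :=
  ∑ i, Measure.map (K.edge i) ((volume.restrict (Icc (0 : ℝ) 1)).withDensity
    fun t => ‖derivWithin (K.edge i) (Icc 0 1) t‖ₑ)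

/-! ### Sobolev space `H¹(K)`, weak Laplacian -/

/-- Smooth functions with compact support in `K`. -/
def IsTestFunction (K : Set Plane) (φ : Plane → ℝ) : Prop :=
  ContDiff ℝ ∞ φ ∧ HasCompactSupport φ ∧ tsupport φ ⊆ K

/-- `G` is a square integrable weak gradient of `v` in `K`. -/
def IsWeakGradient (K : Set Plane) (v : Plane → ℝ) (G : Plane → Plane) : Prop :=
  MemLp G 2 (volume.restrict K) ∧
    ∀ φ, IsTestFunction K φ → ∫ x in K, v x • gradient φ x = -∫ x in K, φ x • G x

/-- `v ∈ H¹(K)`. -/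
def MemH1 (K : Set Plane) (v : Plane → ℝ) : Prop :=
  MemLp v 2 (volume.restrict K) ∧ ∃ G, IsWeakGradient K v G

open Classical in
/-- The weak gradient of a function in `H¹(K)`; it is unique up to null sets. -/
noncomputable def weakGradient (K : Set Plane) (v : Plane → ℝ) : Plane → Plane :=
  if h : ∃ G, IsWeakGradient K v G then h.choose else 0

/-- The `H¹(K)` norm. -/
noncomputable def h1Norm (K : Set Plane) (v : Plane → ℝ) : ℝ :=
  Real.sqrt ((∫ x in K, v x ^ 2) + ∫ x in K, ‖weakGradient K v x‖ ^ 2)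

/-- `Δ v = d` weakly in `K`, for `v ∈ H¹(K)` and `d ∈ L²(K)`. -/
def HasWeakLaplacian (K : Set Plane) (v d : Plane → ℝ) : Prop :=
  MemLp d 2 (volume.restrict K) ∧
    ∀ φ, IsTestFunction K φ →
      ∫ x in K, ⟪weakGradient K v x, gradient φ x⟫ = -∫ x in K, d x * φ x

/-! ### Boundary traces -/

/-- `f ∈ L²(∂K)` is the trace on `∂K` of `v ∈ H¹(K)`: the extension by continuity, from
`H¹(K)` to `L²(∂K)`, of the restriction of smooth functions to the boundary. -/
def HasTrace (K : CurvilinearPolygon) (v f : Plane → ℝ) : Prop :=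
  MemLp f 2 K.ds ∧ ∃ φ : ℕ → Plane → ℝ, (∀ k, ContDiff ℝ ∞ (φ k)) ∧
    Tendsto (fun k => eLpNorm (φ k - v) 2 (volume.restrict K.carrier)) atTop (𝓝 0) ∧
    Tendsto (fun k => eLpNorm (gradient (φ k) - weakGradient K.carrier v) 2
      (volume.restrict K.carrier)) atTop (𝓝 0) ∧
    Tendsto (fun k => eLpNorm (φ k - f) 2 K.ds) atTop (𝓝 0)

/-- The divergence of a differentiable vector field. -/
noncomputable def divergence (F : Plane → Plane) (x : Plane) : ℝ :=
  ∑ i, fderiv ℝ F x (EuclideanSpace.single i 1) i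

/-- `ℓ` is the normal derivative `∂v/∂n ∈ H^{-1/2}(∂K)` of a function `v ∈ H¹(K)` with
`Δ v ∈ L²(K)`, that is, the normal trace of the field `∇v ∈ H(div; K)`: the extension by
continuity, from `H(div; K)` to the dual `H^{-1/2}(∂K)` of the space `H^{1/2}(∂K)` of traces of
`H¹(K)` functions (with the quotient norm), of the map taking a smooth field `F` to `F · n`, the
latter acting by `f ↦ ∫_{∂K} (F · n) f ds`. The number `ℓ f` is thus the value of the boundary
integral `∫_{∂K} (∂v/∂n) f ds`. Only the values of `ℓ` at traces are relevant. -/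
def IsNormalDerivative (K : CurvilinearPolygon) (v : Plane → ℝ) (ℓ : (Plane → ℝ) → ℝ) : Prop :=
  ∃ (d : Plane → ℝ) (F : ℕ → Plane → Plane),
    HasWeakLaplacian K.carrier v d ∧ (∀ k, ContDiff ℝ ∞ (F k)) ∧
    Tendsto (fun k => eLpNorm (F k - weakGradient K.carrier v) 2
      (volume.restrict K.carrier)) atTop (𝓝 0) ∧
    Tendsto (fun k => eLpNorm (divergence (F k) - d) 2 (volume.restrict K.carrier)) atTop (𝓝 0) ∧
    ∀ ε > 0, ∀ᶠ k in atTop, ∀ w f, MemH1 K.carrier w → HasTrace K w f →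
      |∫ x, ⟪F k x, outwardNormal K.carrier x⟫ * f x ∂K.ds - ℓ f| ≤ ε * h1Norm K.carrier w

open Classical in
/-- The normal derivative `∂v/∂n`, as a functional on traces. -/
noncomputable def normalDerivative (K : CurvilinearPolygon) (v : Plane → ℝ) : (Plane → ℝ) → ℝ :=
  if h : ∃ ℓ, IsNormalDerivative K v ℓ then h.choose else 0

/-- The normal derivative of `v` is (represented by) the integrable function `g` on `∂K`. -/
def NormalDerivativeIsFunction (K : CurvilinearPolygon) (v g : Plane → ℝ) : Prop :=
  Integrable g K.ds ∧
    ∀ φ, ContDiff ℝ ∞ φ → normalDerivative K v φ = ∫ x, g x * φ x ∂K.ds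

/-! ### Polynomials and the local spaces -/

/-- The space `ℙ_k` of polynomials of total degree at most `k`; it is `{0}` for `k < 0`. -/
def polySpace (k : ℤ) : Set (MvPolynomial (Fin 2) ℝ) :=
  {p | p ≠ 0 → (p.totalDegree : ℤ) ≤ k}

/-- The function on the plane given by a polynomial. -/
noncomputable def polyFun (p : MvPolynomial (Fin 2) ℝ) (x : Plane) : ℝ :=
  MvPolynomial.eval (fun i => x i) p

/-- The Laplacian of a polynomial. -/
noncomputable def polyLaplacian (p : MvPolynomial (Fin 2) ℝ) : MvPolynomial (Fin 2) ℝ :=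
  ∑ i, MvPolynomial.pderiv i (MvPolynomial.pderiv i p)

/-- `ℙ*_m(∂K)`: continuous functions on `∂K` that are polynomials of degree at most `m` on each
edge. -/
def polyStar (K : CurvilinearPolygon) (m : ℕ) : Set (Plane → ℝ) :=
  {f | ContinuousOn f (frontier K.carrier) ∧
    ∀ i, ∃ p ∈ polySpace m, EqOn f (polyFun p) (K.edge i '' Icc 0 1)}

/-- `V_m^{∂K}(K)`: harmonic functions in `H¹(K)` with trace in `ℙ*_m(∂K)`. -/
def boundarySpace (K : CurvilinearPolygon) (m : ℕ) : Set (Plane → ℝ) :=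
  {v | MemH1 K.carrier v ∧ HasWeakLaplacian K.carrier v 0 ∧ ∃ f ∈ polyStar K m, HasTrace K v f}

/-- `V_m^K(K)`: functions in `H¹(K)` with zero trace and Laplacian in `ℙ_{m-2}(K)`. -/
def interiorSpace (K : CurvilinearPolygon) (m : ℕ) : Set (Plane → ℝ) :=
  {v | MemH1 K.carrier v ∧
    (∃ p ∈ polySpace ((m : ℤ) - 2), HasWeakLaplacian K.carrier v (polyFun p)) ∧ HasTrace K v 0}

/-! ### A smooth partition of unity on a compact set -/

/-! Everything rests on one generalised Green formula, `normalDerivative_apply`: if `v` is in `H¹`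
with weak Laplacian `d`, and `f` is the trace of `w`, then the normal derivative of `v` at `f` is `∫
∇v · ∇w + ∫ d w`. Evaluating it at the zero trace, once with a function `w` of zero trace and once
with the function `0`, gives `∫ ∇v · ∇w = -∫ d w`, and hence the orthogonality of harmonic functions
to functions of zero trace. For harmonic `v` it is the second formula. For the third, `w - Q` is
harmonic, so `∇(w - Q)` is orthogonal to `∇v`, and Green's formula is applied to `v` and `Q`.

The Green formula needs three things. The divergence theorem for smooth fields is localised by a
partition of unity: in a chart the domain is a Lipschitz epigraph (`integral_epigraph`), and the
flux through the graph is matched with the arc length integral over the edges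
(`IsEpigraphOn.integral_inner_outwardNormal`). Passing to the limit in the smooth functions that
define a trace extends it to `H¹` functions (`green`). Finally, smooth fields are dense in `H(div;
K)` (`exists_smooth_approx`). This is proved by duality: a pair `(E, h)` orthogonal to all `(F, div
F)` makes the zero extension of `h` a weakly differentiable function on the plane with gradient `E`.
After localisation it can be pushed into the domain and mollified to a test function, so it is
orthogonal to `(G, div G)` for every `G` in `H(div; K)`.

When the normal derivative is an integrable function `g`, its action is known only on smooth
functions. `normalDerivative_eq_integral_of_bounded` extends it to bounded traces: truncated smooth
approximations stay bounded in `H¹` and converge on the boundary, so both the functional and the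
integral against `g` pass to the limit. -/

theorem exists_smooth_cutoff (x : Plane) {r : ℝ} (hr : 0 < r) :
    ∃ f : Plane → ℝ, ContDiff ℝ ∞ f ∧ HasCompactSupport f ∧ tsupport f ⊆ Metric.ball x r ∧
      ∀ y ∈ Metric.ball x (r / 3), f y = 1 := by
  let f : ContDiffBump x := ⟨r / 3, r / 2, by positivity, by linarith⟩
  refine ⟨f, f.contDiff, f.hasCompactSupport, ?_, fun y hy => ?_⟩
  · rw [f.tsupport_eq]
    exact Metric.closedBall_subset_ball (by change r / 2 < r; linarith)
  · exact f.one_of_mem_closedBall (Metric.ball_subset_closedBall hy)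

/-- The functions are the telescoping products `f a * ∏ (1 - f x)`. Their sum is `1 - ∏ (1 - f x)`,
which equals one wherever some `f x` does, so no division by a sum is needed. -/
theorem exists_smooth_partition {S : Set Plane} (hS : IsCompact S) (r : Plane → ℝ)
    (hr : ∀ x ∈ S, 0 < r x) :
    ∃ (s : Finset Plane) (χ : Plane → Plane → ℝ), (∀ x ∈ s, x ∈ S) ∧
      (∀ x ∈ s, ContDiff ℝ ∞ (χ x) ∧ HasCompactSupport (χ x) ∧
        tsupport (χ x) ⊆ Metric.ball x (r x)) ∧
      ∀ y ∈ S, ∑ x ∈ s, χ x y = 1 := by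
  classical
  choose! f hf1 hf2 hf3 hf4 using fun x (hx : x ∈ S) => exists_smooth_cutoff x (hr x hx)
  obtain ⟨s, hsS, hs⟩ := hS.elim_nhds_subcover (fun x => Metric.ball x (r x / 3))
    fun x hx => Metric.ball_mem_nhds x (by have := hr x hx; positivity)
  have key : ∀ s : Finset Plane, (∀ x ∈ s, x ∈ S) → ∃ χ : Plane → Plane → ℝ,
      (∀ x ∈ s, ContDiff ℝ ∞ (χ x) ∧ HasCompactSupport (χ x) ∧
        tsupport (χ x) ⊆ Metric.ball x (r x)) ∧
      ∀ y, ∑ x ∈ s, χ x y = 1 - ∏ x ∈ s, (1 - f x y) := by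
    intro s
    induction s using Finset.induction_on with
    | empty => exact fun _ => ⟨fun _ _ => 0, by simp, by simp⟩
    | insert a s ha ih =>
      intro hsS
      obtain ⟨χ, h1, h2⟩ := ih fun x hx => hsS x (Finset.mem_insert_of_mem hx)
      have haS := hsS a (Finset.mem_insert_self a s)
      refine ⟨Function.update χ a fun y => f a y * ∏ x ∈ s, (1 - f x y), fun x hx => ?_, fun y => ?_⟩
      · rcases eq_or_ne x a with rfl | hxa
        · rw [Function.update_self]
          refine ⟨(hf1 x haS).mul (contDiff_prod fun i hi => contDiff_const.sub
            (hf1 i (hsS i (Finset.mem_insert_of_mem hi)))), (hf2 x haS).mul_right, ?_⟩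
          exact (tsupport_mul_subset_left).trans (hf3 x haS)
        · rw [Function.update_of_ne hxa]
          exact h1 x (Finset.mem_of_mem_insert_of_ne hx hxa)
      · rw [Finset.sum_insert ha, Finset.prod_insert ha, Function.update_self]
        have : ∑ x ∈ s, Function.update χ a (fun y => f a y * ∏ x ∈ s, (1 - f x y)) x y
            = ∑ x ∈ s, χ x y :=
          Finset.sum_congr rfl fun x hx => by
            rw [Function.update_of_ne]; rintro rfl; exact ha hx
        rw [this, h2]; ring
  obtain ⟨χ, h1, h2⟩ := key s hsS
  refine ⟨s, χ, hsS, h1, fun y hy => ?_⟩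
  obtain ⟨x, hx, hyx⟩ := mem_iUnion₂.1 (hs hy)
  rw [h2, Finset.prod_eq_zero hx (by rw [hf4 x (hsS x hx) y hyx, sub_self]), sub_zero]

/-! ### The divergence theorem over an epigraph -/

theorem LipschitzWith.integral_deriv_eq_zero {h : ℝ → ℝ} {C : NNReal} (hh : LipschitzWith C h)
    (hc : HasCompactSupport h) : ∫ x, deriv h x = 0 := by
  -- The direction `-1` is reversed by the integration by parts, so that `h` is differentiated in
  -- direction `1`.
  have h1 := LipschitzWith.integral_lineDeriv_mul_eq (μ := volume)
    (LipschitzWith.const (α := ℝ) (1 : ℝ)) hh hc (-1)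
  have h0 : ∀ x : ℝ, lineDeriv ℝ (fun _ : ℝ => (1 : ℝ)) x (-1) = 0 := fun x => by
    simp [lineDeriv]
  simp only [h0, zero_mul, integral_zero, neg_neg, mul_one] at h1
  rw [h1]
  refine integral_congr_ae ?_
  filter_upwards [hh.ae_differentiableAt] with x hx
  rw [hx.lineDeriv_eq_fderiv, fderiv_apply_one_eq_deriv]

/-- The shear `(x, u) ↦ (x, ψ x + u)` preserves Lebesgue measure and flattens the epigraph to a half
plane. There the integrand splits into a derivative in `x`, which integrates to zero along each
translated graph, and a derivative in `u`, whose integral over the half line leaves the boundary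
value. Lipschitz regularity of `ψ` suffices, since only almost every derivative enters. -/
theorem integral_epigraph {ψ : ℝ → ℝ} {L : NNReal} (hψ : LipschitzWith L ψ) {a b : ℝ × ℝ → ℝ}
    (ha : ContDiff ℝ 1 a) (hb : ContDiff ℝ 1 b) (ha' : HasCompactSupport a)
    (hb' : HasCompactSupport b) :
    ∫ p in {p : ℝ × ℝ | ψ p.1 < p.2}, (fderiv ℝ a p (1, 0) + fderiv ℝ b p (0, 1)) =
      ∫ x, (deriv ψ x * a (x, ψ x) - b (x, ψ x)) := by
  have hψc := hψ.continuous
  let T : ℝ × ℝ ≃ₜ ℝ × ℝ :=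
    { toFun := fun p => (p.1, ψ p.1 + p.2)
      invFun := fun p => (p.1, p.2 - ψ p.1)
      left_inv := fun p => by simp
      right_inv := fun p => by simp
      continuous_toFun := by fun_prop
      continuous_invFun := by fun_prop }
  have hT : MeasurePreserving T (volume : Measure (ℝ × ℝ)) volume := by
    have := (MeasurePreserving.id (volume : Measure ℝ)).skew_product (μc := volume)
      (g := fun x u => ψ x + u) (μd := (volume : Measure ℝ)) (by fun_prop)
      (ae_of_all _ fun x => (measurePreserving_add_left volume (ψ x)).map_eq)
    exact this
  have hpre : T ⁻¹' {p : ℝ × ℝ | ψ p.1 < p.2} = univ ×ˢ Ioi 0 := by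
    ext p; simp [T]
  rw [← hT.setIntegral_preimage_emb T.measurableEmbedding, hpre]
  have hTc : Continuous T := T.continuous
  have hcs : ∀ {f : ℝ × ℝ → ℝ}, HasCompactSupport f → HasCompactSupport (f ∘ T) := fun hf =>
    hf.comp_homeomorph T
  have hda : ∀ v, Continuous fun p => fderiv ℝ a p v := fun v =>
    (ha.continuous_fderiv one_ne_zero).clm_apply continuous_const
  have hdb : ∀ v, Continuous fun p => fderiv ℝ b p v := fun v =>
    (hb.continuous_fderiv one_ne_zero).clm_apply continuous_const
  have hda' : ∀ v, HasCompactSupport fun p => fderiv ℝ a p v := fun v => ha'.fderiv_apply ℝ v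
  have hdb' : ∀ v, HasCompactSupport fun p => fderiv ℝ b p v := fun v => hb'.fderiv_apply ℝ v
  have hia : ∀ v, Integrable fun p => fderiv ℝ a (T p) v := fun v =>
    ((hda v).comp hTc).integrable_of_hasCompactSupport (hcs (hda' v))
  have hib : ∀ v, Integrable fun p => fderiv ℝ b (T p) v := fun v =>
    ((hdb v).comp hTc).integrable_of_hasCompactSupport (hcs (hdb' v))
  have hia' : Integrable fun p : ℝ × ℝ => deriv ψ p.1 * fderiv ℝ a (T p) (0, 1) :=
    (hia (0, 1)).bdd_mul (c := L) ((measurable_deriv ψ).comp measurable_fst).aestronglyMeasurable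
      (ae_of_all _ fun p => norm_deriv_le_of_lipschitz hψ)
  have hdT : ∀ p, HasFDerivAt a (fderiv ℝ a p) p := fun p =>
    (ha.differentiable one_ne_zero p).hasFDerivAt
  have hdTb : ∀ p, HasFDerivAt b (fderiv ℝ b p) p := fun p =>
    (hb.differentiable one_ne_zero p).hasFDerivAt
  -- The first bracket is, for almost every `x`, the `x`-derivative of `a (x, ψ x + u)`; the second
  -- is the `u`-derivative of `b - ψ' a` along the vertical line.
  have hsplit : ∀ p, fderiv ℝ a (T p) (1, 0) + fderiv ℝ b (T p) (0, 1) =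
      (fderiv ℝ a (T p) (1, 0) + deriv ψ p.1 * fderiv ℝ a (T p) (0, 1)) +
      (fderiv ℝ b (T p) (0, 1) - deriv ψ p.1 * fderiv ℝ a (T p) (0, 1)) := fun p => by ring
  simp_rw [hsplit]
  have hI1 : Integrable fun p => fderiv ℝ a (T p) (1, 0) + deriv ψ p.1 * fderiv ℝ a (T p) (0, 1) :=
    (hia (1, 0)).add hia'
  have hI2 : Integrable fun p => fderiv ℝ b (T p) (0, 1) - deriv ψ p.1 * fderiv ℝ a (T p) (0, 1) :=
    (hib (0, 1)).sub hia'
  rw [integral_add hI1.integrableOn hI2.integrableOn]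
  have hvol : (volume : Measure (ℝ × ℝ)).restrict (univ ×ˢ Ioi 0) =
      (volume : Measure ℝ).prod (volume.restrict (Ioi 0)) := by
    rw [Measure.volume_eq_prod, ← Measure.prod_restrict, Measure.restrict_univ]
  have h1 : ∫ p in univ ×ˢ Ioi (0 : ℝ),
      (fderiv ℝ a (T p) (1, 0) + deriv ψ p.1 * fderiv ℝ a (T p) (0, 1)) = 0 := by
    have hI := hI1.integrableOn (s := univ ×ˢ Ioi (0 : ℝ))
    rw [IntegrableOn, hvol] at hI
    rw [hvol, integral_prod_symm _ hI]
    refine integral_eq_zero_of_ae (ae_of_all _ fun u => ?_)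
    obtain ⟨C, hC⟩ := ha.lipschitzWith_of_hasCompactSupport ha' one_ne_zero
    have hlip : LipschitzWith (C * max 1 L) fun x => a (x, ψ x + u) := by
      have h2 : LipschitzWith L fun x => ψ x + u := by
        simpa using hψ.add (LipschitzWith.const u)
      exact hC.comp (LipschitzWith.id.prodMk h2)
    have hcpt : HasCompactSupport fun x => a (x, ψ x + u) := by
      refine HasCompactSupport.of_support_subset_isCompact (ha'.isCompact.image continuous_fst)
        fun x hx => ⟨(x, ψ x + u), subset_tsupport _ hx, rfl⟩
    change ∫ x, (fderiv ℝ a (x, ψ x + u) (1, 0) +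
      deriv ψ x * fderiv ℝ a (x, ψ x + u) (0, 1)) = 0
    refine (integral_congr_ae ?_).trans (hlip.integral_deriv_eq_zero hcpt)
    filter_upwards [hψ.ae_differentiableAt] with x hx
    have h3 : HasDerivAt (fun x => (x, ψ x + u)) ((1 : ℝ), deriv ψ x) x :=
      (hasDerivAt_id x).prodMk (hx.hasDerivAt.add_const u)
    have h4 := (hdT (x, ψ x + u)).comp_hasDerivAt x h3
    have h5 : ((1 : ℝ), deriv ψ x) = (1, 0) + deriv ψ x • (0, 1) := by simp
    rw [h5, map_add, map_smul, smul_eq_mul] at h4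
    exact h4.deriv.symm
  have h2 : ∫ p in univ ×ˢ Ioi (0 : ℝ),
      (fderiv ℝ b (T p) (0, 1) - deriv ψ p.1 * fderiv ℝ a (T p) (0, 1)) =
      ∫ x, (deriv ψ x * a (x, ψ x) - b (x, ψ x)) := by
    have hI := hI2.integrableOn (s := univ ×ˢ Ioi (0 : ℝ))
    rw [IntegrableOn, hvol] at hI
    rw [hvol, integral_prod _ hI]
    refine integral_congr_ae ?_
    filter_upwards [hI.prod_right_ae] with x hx
    have hd : ∀ {c : ℝ × ℝ → ℝ} (u : ℝ), HasFDerivAt c (fderiv ℝ c (x, ψ x + u)) (x, ψ x + u) →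
        HasDerivAt (fun u => c (x, ψ x + u)) (fderiv ℝ c (x, ψ x + u) (0, 1)) u := by
      intro c u hc
      exact hc.comp_hasDerivAt u ((hasDerivAt_const u x).prodMk ((hasDerivAt_id u).const_add (ψ x)))
    have hz : ∀ {c : ℝ × ℝ → ℝ}, HasCompactSupport c →
        Tendsto (fun u => c (x, ψ x + u)) atTop (𝓝 0) := by
      intro c hc
      have hcpt : HasCompactSupport fun u => c (x, ψ x + u) := by
        refine HasCompactSupport.of_support_subset_isCompact
          (hc.isCompact.image (continuous_snd.sub continuous_const : Continuous
            fun p : ℝ × ℝ => p.2 - ψ x)) fun u hu => ⟨(x, ψ x + u), subset_tsupport _ hu, by simp⟩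
      refine tendsto_const_nhds.congr' ?_
      have := hcpt.isCompact.bddAbove
      obtain ⟨M, hM⟩ := this
      filter_upwards [eventually_gt_atTop M] with u hu
      by_contra hne
      exact absurd (hM (subset_tsupport _ (Ne.symm hne))) (not_le.2 hu)
    have h6 := integral_Ioi_of_hasDerivAt_of_tendsto' (a := 0)
      (f := fun u => b (x, ψ x + u) - deriv ψ x * a (x, ψ x + u))
      (f' := fun u => fderiv ℝ b (x, ψ x + u) (0, 1) -
        deriv ψ x * fderiv ℝ a (x, ψ x + u) (0, 1))
      (fun u _ => (hd u (hdTb _)).sub ((hd u (hdT _)).const_mul _)) hx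
      (m := 0 - deriv ψ x * 0) ((hz hb').sub ((hz ha').const_mul _))
    change ∫ u in Ioi 0, (fderiv ℝ b (x, ψ x + u) (0, 1) -
        deriv ψ x * fderiv ℝ a (x, ψ x + u) (0, 1)) = _
    rw [h6]; simp
  rw [h1, h2, zero_add]

/-! ### Charts of the boundary -/

/-- In the open set `B` and in the coordinates `e`, the set `K` is the strict epigraph of `ψ`. -/
structure IsEpigraphOn (K B : Set Plane) (e : Plane ≃ₗᵢ[ℝ] Plane) (ψ : ℝ → ℝ) (L : NNReal) :
    Prop where
  isOpen : IsOpen B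
  lipschitz : LipschitzWith L ψ
  mem_iff : ∀ y ∈ B, y ∈ K ↔ ψ (e y 0) < e y 1

/-- The normal of an epigraph in rotated coordinates. -/
noncomputable def epigraphNormal (e : Plane ≃ₗᵢ[ℝ] Plane) (d : ℝ) : Plane :=
  e.symm ((Real.sqrt (1 + d ^ 2))⁻¹ • !₂[d, -1])

theorem inner_epigraphNormal (e : Plane ≃ₗᵢ[ℝ] Plane) (d : ℝ) (y : Plane) :
    ⟪y, epigraphNormal e d⟫ = (Real.sqrt (1 + d ^ 2))⁻¹ * (d * e y 0 - e y 1) := by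
  rw [epigraphNormal, ← e.inner_map_map, e.apply_symm_apply, inner_smul_right]
  congr 1
  simp [PiLp.inner_apply, Fin.sum_univ_two]; ring

theorem norm_epigraphNormal (e : Plane ≃ₗᵢ[ℝ] Plane) (d : ℝ) : ‖epigraphNormal e d‖ = 1 := by
  have h : 0 < Real.sqrt (1 + d ^ 2) := Real.sqrt_pos.2 (by positivity)
  rw [epigraphNormal, e.symm.norm_map, norm_smul, EuclideanSpace.norm_eq, Fin.sum_univ_two]
  simp only [Real.norm_eq_abs, sq_abs, Matrix.cons_val_zero, Matrix.cons_val_one]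
  rw [abs_of_pos (inv_pos.2 h), show d ^ 2 + (-1) ^ 2 = 1 + d ^ 2 by ring, inv_mul_cancel₀ h.ne']

theorem abs_coord_le_norm (e : Plane ≃ₗᵢ[ℝ] Plane) (y : Plane) (i : Fin 2) : |e y i| ≤ ‖y‖ := by
  rw [← e.norm_map y]; exact PiLp.norm_apply_le (e y) i

theorem continuous_coord (e : Plane ≃ₗᵢ[ℝ] Plane) (i : Fin 2) : Continuous fun y => e y i :=
  (EuclideanSpace.proj (𝕜 := ℝ) i).continuous.comp e.continuous

namespace IsEpigraphOn

variable {K B : Set Plane} {e : Plane ≃ₗᵢ[ℝ] Plane} {ψ : ℝ → ℝ} {L : NNReal}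

theorem coord_le (h : IsEpigraphOn K B e ψ L) {y : Plane} (hy : y ∈ B) (hyK : y ∈ closure K) :
    ψ (e y 0) ≤ e y 1 := by
  by_contra! hlt
  have hU : IsOpen {z | e z 1 < ψ (e z 0)} :=
    isOpen_lt (continuous_coord e 1) (h.lipschitz.continuous.comp (continuous_coord e 0))
  obtain ⟨z, ⟨hzB, hz⟩, hzK⟩ := mem_closure_iff.1 hyK _ (h.isOpen.inter hU) ⟨hy, hlt⟩
  exact lt_asymm hz ((h.mem_iff z hzB).1 hzK)

theorem mem_frontier_iff (h : IsEpigraphOn K B e ψ L) (hK : IsOpen K) {y : Plane} (hy : y ∈ B) :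
    y ∈ frontier K ↔ e y 1 = ψ (e y 0) := by
  rw [hK.frontier_eq]
  constructor
  · rintro ⟨h1, h2⟩
    exact le_antisymm (not_lt.1 fun h3 => h2 ((h.mem_iff y hy).2 h3)) (h.coord_le hy h1)
  · intro heq
    refine ⟨?_, fun h2 => (((h.mem_iff y hy).1 h2).ne heq.symm).elim⟩
    have htend : Tendsto (fun s : ℝ => y + s • e.symm !₂[0, 1]) (𝓝[>] 0) (𝓝 y) := by
      have h4 : Tendsto (fun s : ℝ => y + s • e.symm !₂[0, 1]) (𝓝 0)
          (𝓝 (y + (0 : ℝ) • e.symm !₂[0, 1])) := Continuous.tendsto (by fun_prop) 0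
      rw [zero_smul, add_zero] at h4
      exact h4.mono_left nhdsWithin_le_nhds
    refine mem_closure_of_tendsto htend ?_
    filter_upwards [htend.eventually (h.isOpen.mem_nhds hy), self_mem_nhdsWithin] with s hs hs0
    rw [h.mem_iff _ hs]
    simpa [heq] using hs0

/-- The graph deviates from its tangent line by at most `ε ‖y - x‖` near `x`, and normalising the
vector `(d, -1)` only shrinks this error. Differentiability of `ψ` at the single point is enough. -/
theorem isOutwardUnitNormal (h : IsEpigraphOn K B e ψ L) {x : Plane} (hx : x ∈ B)
    (hxψ : e x 1 = ψ (e x 0)) {d : ℝ} (hd : HasDerivAt ψ d (e x 0)) :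
    IsOutwardUnitNormal K x (epigraphNormal e d) := by
  refine ⟨norm_epigraphNormal e d, fun ε hε => ?_⟩
  have hO := hasDerivAt_iff_isLittleO.1 hd
  have hev := (hO.def hε)
  have hev' : ∀ᶠ y in 𝓝 x, ‖ψ (e y 0) - ψ (e x 0) - (e y 0 - e x 0) • d‖ ≤
      ε * ‖e y 0 - e x 0‖ := (continuous_coord e 0).continuousAt.eventually hev
  filter_upwards [hev', h.isOpen.mem_nhds hx] with y hy hyB
  have hs : 1 ≤ Real.sqrt (1 + d ^ 2) := Real.one_le_sqrt.2 (by nlinarith [sq_nonneg d])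
  have hs1 : (Real.sqrt (1 + d ^ 2))⁻¹ ≤ 1 := inv_le_one_of_one_le₀ hs
  have hs0 : 0 ≤ (Real.sqrt (1 + d ^ 2))⁻¹ := by positivity
  have h0 : |e y 0 - e x 0| ≤ ‖y - x‖ := by
    have := abs_coord_le_norm e (y - x) 0
    simpa using this
  rw [inner_epigraphNormal, h.mem_iff y hyB]
  simp only [map_sub, PiLp.sub_apply]
  rw [Real.norm_eq_abs, Real.norm_eq_abs, smul_eq_mul] at hy
  have hy' := abs_le.1 (hy.trans (mul_le_mul_of_nonneg_left h0 hε.le))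
  have hn : 0 ≤ ε * ‖y - x‖ := by positivity
  set A := d * (e y 0 - e x 0) - (e y 1 - e x 1) with hA
  constructor
  · intro hyK
    have : A ≤ ε * ‖y - x‖ := by rw [hA]; nlinarith
    nlinarith
  · intro hyK
    have : -(ε * ‖y - x‖) ≤ A := by rw [hA]; nlinarith
    nlinarith

theorem outwardNormal_eq (h : IsEpigraphOn K B e ψ L) {x : Plane} (hx : x ∈ B)
    (hxψ : e x 1 = ψ (e x 0)) (hd : DifferentiableAt ℝ ψ (e x 0)) :
    outwardNormal K x = epigraphNormal e (deriv ψ (e x 0)) := by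
  have h1 := h.isOutwardUnitNormal hx hxψ hd.hasDerivAt
  have hex : ∃ ν, IsOutwardUnitNormal K x ν := ⟨_, h1⟩
  rw [outwardNormal, dif_pos hex]
  exact hex.choose_spec.unique h1

end IsEpigraphOn

/-- A regular curve in the graph of a Lipschitz function is not vertical. -/
theorem coord_zero_ne_zero_of_curve_in_graph {ψ : ℝ → ℝ} {L : NNReal} (hψ : LipschitzWith L ψ)
    {e : Plane ≃ₗᵢ[ℝ] Plane} {γ : ℝ → Plane} {γ' : Plane} {t : ℝ} (hγ : HasDerivAt γ γ' t)
    (h0 : γ' ≠ 0) (hgr : ∀ᶠ u in 𝓝 t, e (γ u) 1 = ψ (e (γ u) 0)) : e γ' 0 ≠ 0 := by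
  intro hz
  have hc : ∀ i, HasDerivAt (fun u => e (γ u) i) (e γ' i) t := fun i => by
    have h1 := e.toContinuousLinearEquiv.hasFDerivAt.comp_hasDerivAt t hγ
    exact (EuclideanSpace.proj (𝕜 := ℝ) i).hasFDerivAt.comp_hasDerivAt t h1
  -- If the horizontal velocity vanished, the Lipschitz bound would make the vertical increment
  -- negligible too, and the curve would not be regular.
  have h1 : HasDerivAt (fun u => e (γ u) 1) 0 t := by
    have hO := hasDerivAt_iff_isLittleO.1 (hc 0)
    rw [hz] at hO
    rw [hasDerivAt_iff_isLittleO]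
    refine Asymptotics.IsBigO.trans_isLittleO (Asymptotics.IsBigO.of_bound L ?_) hO
    filter_upwards [hgr] with u hu
    have := hψ.dist_le_mul (e (γ u) 0) (e (γ t) 0)
    simpa [hu, hgr.self_of_nhds, Real.dist_eq] using this
  have h2 := (hc 1).unique h1
  apply h0
  rw [← e.map_eq_zero_iff]
  ext i
  fin_cases i
  · exact hz
  · exact h2

/-- Since the horizontal velocity is nonzero, the inverse function theorem inverts the horizontal
coordinate of the curve; near the point `ψ` is the vertical coordinate composed with this inverse. A
merely Lipschitz chart is thus differentiable wherever a smooth edge runs through it. -/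
theorem hasDerivAt_of_curve_in_graph {ψ : ℝ → ℝ} {L : NNReal} (hψ : LipschitzWith L ψ)
    {e : Plane ≃ₗᵢ[ℝ] Plane} {γ : ℝ → Plane} {γ' : Plane} {t : ℝ} (hγ : HasStrictDerivAt γ γ' t)
    (h0 : γ' ≠ 0) (hgr : ∀ᶠ u in 𝓝 t, e (γ u) 1 = ψ (e (γ u) 0)) :
    HasDerivAt ψ (e γ' 1 / e γ' 0) (e (γ t) 0) := by
  have hne := coord_zero_ne_zero_of_curve_in_graph hψ hγ.hasDerivAt h0 hgr
  have hc : ∀ i, HasStrictDerivAt (fun u => e (γ u) i) (e γ' i) t := fun i => by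
    have h1 := e.toContinuousLinearEquiv.hasStrictFDerivAt.comp_hasStrictDerivAt t hγ
    exact (EuclideanSpace.proj (𝕜 := ℝ) i).hasStrictFDerivAt.comp_hasStrictDerivAt t h1
  have hinv := (hc 0).to_localInverse hne
  set s := (hc 0).localInverse (fun u => e (γ u) 0) (e γ' 0) t hne with hs
  have hst : s (e (γ t) 0) = t :=
    ((hc 0).hasStrictFDerivAt_equiv hne).localInverse_apply_image
  have hright : ∀ᶠ σ in 𝓝 (e (γ t) 0), e (γ (s σ)) 0 = σ :=
    ((hc 0).hasStrictFDerivAt_equiv hne).eventually_right_inverse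
  have h1 : HasDerivAt (fun u => e (γ u) 1) (e γ' 1) (s (e (γ t) 0)) := by
    rw [hst]; exact (hc 1).hasDerivAt
  have h2 := h1.comp _ hinv.hasDerivAt
  rw [← div_eq_mul_inv] at h2
  refine h2.congr_of_eventuallyEq ?_
  have hcont : Tendsto s (𝓝 (e (γ t) 0)) (𝓝 t) := by
    have := hinv.hasDerivAt.continuousAt.tendsto; rwa [hst] at this
  filter_upwards [hright, hcont.eventually hgr] with σ h3 h4
  rw [Function.comp_apply, h4, h3]

/-! ### Edges and arc length -/

namespace CurvilinearPolygon

variable (K : CurvilinearPolygon)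

theorem edge_continuousOn (i : Fin K.numEdges) : ContinuousOn (K.edge i) (Icc 0 1) :=
  (K.edge_smooth i).continuousOn

theorem edge_hasStrictDerivAt (i : Fin K.numEdges) {t : ℝ} (ht : t ∈ Ioo (0 : ℝ) 1) :
    HasStrictDerivAt (K.edge i) (derivWithin (K.edge i) (Icc 0 1) t) t := by
  have hn : Icc (0 : ℝ) 1 ∈ 𝓝 t := Icc_mem_nhds ht.1 ht.2
  rw [derivWithin_of_mem_nhds hn]
  exact ((K.edge_smooth i).contDiffAt hn).hasStrictDerivAt (by simp)

theorem edge_injOn (i : Fin K.numEdges) : InjOn (K.edge i) (Ioo 0 1) :=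
  (K.edge_injOn_left i).mono Ioo_subset_Ico_self

theorem edge_mem_frontier (i : Fin K.numEdges) {t : ℝ} (ht : t ∈ Icc (0 : ℝ) 1) :
    K.edge i t ∈ frontier K.carrier := by
  rw [K.frontier_eq]; exact mem_iUnion.2 ⟨i, mem_image_of_mem _ ht⟩

theorem isCompact_closure : IsCompact (closure K.carrier) :=
  K.isBounded.isCompact_closure

theorem isCompact_frontier : IsCompact (frontier K.carrier) :=
  K.isCompact_closure.of_isClosed_subset isClosed_frontier frontier_subset_closure

/-- The speed of an edge. -/
noncomputable def speed (i : Fin K.numEdges) (t : ℝ) : ℝ :=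
  ‖derivWithin (K.edge i) (Icc 0 1) t‖

theorem speed_continuousOn (i : Fin K.numEdges) : ContinuousOn (K.speed i) (Icc 0 1) :=
  ((K.edge_smooth i).continuousOn_derivWithin (uniqueDiffOn_Icc zero_lt_one) (by simp)).norm

/-- Arc length along an edge, as a measure on the parameter interval. -/
noncomputable def edgeMeasure (i : Fin K.numEdges) : Measure ℝ :=
  (volume.restrict (Icc (0 : ℝ) 1)).withDensity
    fun t => ‖derivWithin (K.edge i) (Icc 0 1) t‖ₑ

theorem edgeMeasure_ac (i : Fin K.numEdges) :
    K.edgeMeasure i ≪ volume.restrict (Icc (0 : ℝ) 1) :=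
  withDensity_absolutelyContinuous _ _

theorem edge_aemeasurable (i : Fin K.numEdges) : AEMeasurable (K.edge i) (K.edgeMeasure i) :=
  ((K.edge_continuousOn i).aemeasurable measurableSet_Icc).mono_ac (K.edgeMeasure_ac i)

theorem ds_eq : K.ds = ∑ i, Measure.map (K.edge i) (K.edgeMeasure i) := rfl

instance isFiniteMeasure_edgeMeasure (i : Fin K.numEdges) : IsFiniteMeasure (K.edgeMeasure i) := by
  refine isFiniteMeasure_withDensity ?_
  have h : IntegrableOn (K.speed i) (Icc 0 1) :=
    (K.speed_continuousOn i).integrableOn_compact isCompact_Icc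
  have h2 := h.hasFiniteIntegral
  rw [hasFiniteIntegral_iff_enorm] at h2
  refine ne_of_lt ?_
  simpa [speed] using h2

instance isFiniteMeasure_ds : IsFiniteMeasure K.ds := by
  rw [ds_eq]; infer_instance

/-- The boundary without the end points of the edges. -/
def openEdges : Set Plane := ⋃ i, K.edge i '' Ioo 0 1

theorem measurableSet_openEdges : MeasurableSet K.openEdges :=
  MeasurableSet.iUnion fun i => measurableSet_Ioo.image_of_continuousOn_injOn
    ((K.edge_continuousOn i).mono Ioo_subset_Icc_self) (K.edge_injOn i)

theorem openEdges_subset_frontier : K.openEdges ⊆ frontier K.carrier := by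
  rintro x hx
  obtain ⟨i, t, ht, rfl⟩ := mem_iUnion.1 hx
  exact K.edge_mem_frontier i (Ioo_subset_Icc_self ht)

theorem ae_edgeMeasure_mem_Ioo (i : Fin K.numEdges) :
    ∀ᵐ t ∂K.edgeMeasure i, t ∈ Ioo (0 : ℝ) 1 := by
  refine (K.edgeMeasure_ac i).ae_le ?_
  rw [← Measure.restrict_congr_set Ioo_ae_eq_Icc]
  exact ae_restrict_mem measurableSet_Ioo

theorem ae_mem_openEdges : ∀ᵐ x ∂K.ds, x ∈ K.openEdges := by
  rw [ds_eq, ← Measure.sum_fintype, Measure.ae_sum_iff]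
  intro i
  refine (ae_map_iff (K.edge_aemeasurable i) K.measurableSet_openEdges).2 ?_
  filter_upwards [K.ae_edgeMeasure_mem_Ioo i] with t ht
  exact mem_iUnion.2 ⟨i, mem_image_of_mem _ ht⟩

theorem ae_mem_frontier : ∀ᵐ x ∂K.ds, x ∈ frontier K.carrier :=
  K.ae_mem_openEdges.mono fun _ h => K.openEdges_subset_frontier h

theorem integral_ds {g : Plane → ℝ} (hg : Integrable g K.ds) :
    ∫ x, g x ∂K.ds = ∑ i, ∫ t in Ioo 0 1, K.speed i t * g (K.edge i t) := by
  have hle : ∀ i, Measure.map (K.edge i) (K.edgeMeasure i) ≤ K.ds := fun i => by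
    rw [ds_eq, ← Measure.sum_fintype]; exact Measure.le_sum _ i
  have hi : ∀ i, Integrable g (Measure.map (K.edge i) (K.edgeMeasure i)) := fun i =>
    hg.mono_measure (hle i)
  rw [ds_eq, integral_finsetSum_measure fun i _ => hi i]
  refine Finset.sum_congr rfl fun i _ => ?_
  rw [integral_map (K.edge_aemeasurable i) (hi i).aestronglyMeasurable, edgeMeasure,
    setIntegral_congr_set Ioo_ae_eq_Icc]
  have hm : AEMeasurable (fun t => ‖derivWithin (K.edge i) (Icc 0 1) t‖₊)
      (volume.restrict (Icc (0 : ℝ) 1)) :=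
    (((K.edge_smooth i).continuousOn_derivWithin (uniqueDiffOn_Icc zero_lt_one)
      (by simp)).aemeasurable measurableSet_Icc).nnnorm
  have := integral_withDensity_eq_integral_smul₀ hm fun t => g (K.edge i t)
  simp only [NNReal.smul_def, smul_eq_mul, coe_nnnorm] at this
  exact this

/-! ### Charts covering the closure, the outward normal -/

theorem exists_chart {x : Plane} (hx : x ∈ frontier K.carrier) :
    ∃ (e : Plane ≃ₗᵢ[ℝ] Plane) (ψ : ℝ → ℝ) (L : NNReal) (ε : ℝ), 0 < ε ∧
      IsEpigraphOn K.carrier (Metric.ball x ε) e ψ L := by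
  obtain ⟨e, ψ, L, ε, h1, h2, h3⟩ := K.lipschitz x hx
  exact ⟨e, ψ, L, ε, h2, Metric.isOpen_ball, h1, h3⟩

end CurvilinearPolygon

namespace IsEpigraphOn

variable {K : CurvilinearPolygon} {B : Set Plane} {e : Plane ≃ₗᵢ[ℝ] Plane} {ψ : ℝ → ℝ} {L : NNReal}

theorem eventually_edge_mem_graph (h : IsEpigraphOn K.carrier B e ψ L) {i : Fin K.numEdges} {t : ℝ}
    (ht : t ∈ Ioo (0 : ℝ) 1) (hB : K.edge i t ∈ B) :
    ∀ᶠ u in 𝓝 t, e (K.edge i u) 1 = ψ (e (K.edge i u) 0) := by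
  have hc : ContinuousAt (K.edge i) t :=
    (K.edge_continuousOn i).continuousAt (Icc_mem_nhds ht.1 ht.2)
  filter_upwards [hc.eventually (h.isOpen.mem_nhds hB), Icc_mem_nhds ht.1 ht.2] with u hu hu'
  exact (h.mem_frontier_iff K.isOpen hu).1 (K.edge_mem_frontier i hu')

theorem edge_coord_ne_zero (h : IsEpigraphOn K.carrier B e ψ L) {i : Fin K.numEdges} {t : ℝ}
    (ht : t ∈ Ioo (0 : ℝ) 1) (hB : K.edge i t ∈ B) :
    e (derivWithin (K.edge i) (Icc 0 1) t) 0 ≠ 0 :=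
  coord_zero_ne_zero_of_curve_in_graph h.lipschitz (K.edge_hasStrictDerivAt i ht).hasDerivAt
    (K.edge_regular i t (Ioo_subset_Icc_self ht)) (h.eventually_edge_mem_graph ht hB)

theorem hasDerivAt_edge (h : IsEpigraphOn K.carrier B e ψ L) {i : Fin K.numEdges} {t : ℝ}
    (ht : t ∈ Ioo (0 : ℝ) 1) (hB : K.edge i t ∈ B) :
    HasDerivAt ψ (e (derivWithin (K.edge i) (Icc 0 1) t) 1 /
      e (derivWithin (K.edge i) (Icc 0 1) t) 0) (e (K.edge i t) 0) :=
  hasDerivAt_of_curve_in_graph h.lipschitz (K.edge_hasStrictDerivAt i ht)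
    (K.edge_regular i t (Ioo_subset_Icc_self ht)) (h.eventually_edge_mem_graph ht hB)

theorem outwardNormal_edge (h : IsEpigraphOn K.carrier B e ψ L) {x : Plane}
    (hx : x ∈ K.openEdges) (hB : x ∈ B) :
    outwardNormal K.carrier x = epigraphNormal e (deriv ψ (e x 0)) := by
  obtain ⟨i, t, ht, rfl⟩ := mem_iUnion.1 hx
  exact h.outwardNormal_eq hB (h.eventually_edge_mem_graph ht hB).self_of_nhds
    (h.hasDerivAt_edge ht hB).differentiableAt

/-- Comparison of the flux through an edge with the flux through the graph. -/
theorem speed_mul_inner_outwardNormal (h : IsEpigraphOn K.carrier B e ψ L) {i : Fin K.numEdges}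
    {t : ℝ} (ht : t ∈ Ioo (0 : ℝ) 1) (hB : K.edge i t ∈ B) (y : Plane) :
    K.speed i t * ⟪y, outwardNormal K.carrier (K.edge i t)⟫ =
      |e (derivWithin (K.edge i) (Icc 0 1) t) 0| *
        (deriv ψ (e (K.edge i t) 0) * e y 0 - e y 1) := by
  have hne := h.edge_coord_ne_zero ht hB
  rw [h.outwardNormal_edge (mem_iUnion.2 ⟨i, mem_image_of_mem _ ht⟩) hB, inner_epigraphNormal,
    (h.hasDerivAt_edge ht hB).deriv, CurvilinearPolygon.speed]
  set γ' := derivWithin (K.edge i) (Icc 0 1) t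
  have hpos : 0 < Real.sqrt (1 + (e γ' 1 / e γ' 0) ^ 2) := Real.sqrt_pos.2 (by positivity)
  -- The speed carries the same root `√(1 + slope²)` as the normalisation of the normal, so the two
  -- cancel.
  have hn : ‖γ'‖ = |e γ' 0| * Real.sqrt (1 + (e γ' 1 / e γ' 0) ^ 2) := by
    rw [← e.norm_map, EuclideanSpace.norm_eq, Fin.sum_univ_two, ← Real.sqrt_sq_eq_abs,
      ← Real.sqrt_mul (sq_nonneg _)]
    congr 1
    simp only [Real.norm_eq_abs, sq_abs]
    field_simp
  rw [hn]
  field_simp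

end IsEpigraphOn

namespace CurvilinearPolygon

variable (K : CurvilinearPolygon)

theorem norm_outwardNormal {x : Plane} (hx : x ∈ K.openEdges) : ‖outwardNormal K.carrier x‖ = 1 := by
  obtain ⟨e, ψ, L, ε, hε, h⟩ := K.exists_chart (K.openEdges_subset_frontier hx)
  rw [h.outwardNormal_edge hx (Metric.mem_ball_self hε), norm_epigraphNormal]

/-- The normal is chosen point by point, so measurability is not automatic. On each chart of a
finite cover it agrees almost everywhere with a Borel function of `deriv ψ`. -/
theorem aestronglyMeasurable_outwardNormal :
    AEStronglyMeasurable (outwardNormal K.carrier) K.ds := by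
  refine AEMeasurable.aestronglyMeasurable ?_
  choose! e ψ L ε hε h using fun x (hx : x ∈ frontier K.carrier) => K.exists_chart hx
  obtain ⟨s, hsS, hs⟩ := K.isCompact_frontier.elim_nhds_subcover (fun x => Metric.ball x (ε x))
    fun x hx => Metric.ball_mem_nhds x (hε x hx)
  have hr : K.ds = K.ds.restrict (⋃ x : s, Metric.ball (x : Plane) (ε x)) := by
    rw [Measure.restrict_eq_self_of_ae_mem]
    refine K.ae_mem_frontier.mono fun x hx => ?_
    obtain ⟨y, hy, hxy⟩ := mem_iUnion₂.1 (hs hx)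
    exact mem_iUnion.2 ⟨⟨y, hy⟩, hxy⟩
  rw [hr, aemeasurable_iUnion_iff]
  rintro ⟨x, hx⟩
  have hch := h x (hsS x hx)
  refine ⟨fun y => epigraphNormal (e x) (deriv (ψ x) (e x y 0)), ?_, ?_⟩
  · have hm : Measurable (epigraphNormal (e x)) := by
      have : Continuous (epigraphNormal (e x)) := by
        unfold epigraphNormal
        have h1 : Continuous fun d : ℝ => (Real.sqrt (1 + d ^ 2))⁻¹ :=
          Continuous.inv₀ (by fun_prop) fun d => (Real.sqrt_pos.2 (by positivity)).ne'
        fun_prop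
      exact this.measurable
    exact hm.comp ((measurable_deriv _).comp (continuous_coord (e x) 0).measurable)
  · filter_upwards [ae_restrict_mem Metric.isOpen_ball.measurableSet,
      ae_restrict_of_ae K.ae_mem_openEdges] with y hy hy'
    exact hch.outwardNormal_edge hy' hy

theorem ae_norm_outwardNormal : ∀ᵐ x ∂K.ds, ‖outwardNormal K.carrier x‖ = 1 :=
  K.ae_mem_openEdges.mono fun _ hx => K.norm_outwardNormal hx

theorem _root_.Continuous.memLp_ds {E : Type*} [NormedAddCommGroup E]
    [SecondCountableTopology E] {F : Plane → E}
    (hF : Continuous F) (K : CurvilinearPolygon) (p : ENNReal) : MemLp F p K.ds := by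
  obtain ⟨C, hC⟩ := K.isCompact_frontier.exists_bound_of_continuousOn hF.continuousOn
  exact MemLp.of_bound hF.aestronglyMeasurable C (K.ae_mem_frontier.mono fun x hx => hC x hx)

theorem memLp_inner_outwardNormal {F : Plane → Plane} (hF : Continuous F) (p : ENNReal) :
    MemLp (fun x => ⟪F x, outwardNormal K.carrier x⟫) p K.ds := by
  obtain ⟨C, hC⟩ := K.isCompact_frontier.exists_bound_of_continuousOn hF.continuousOn
  refine MemLp.of_bound (hF.aestronglyMeasurable.inner K.aestronglyMeasurable_outwardNormal) C ?_
  filter_upwards [K.ae_mem_frontier, K.ae_norm_outwardNormal] with x hx hn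
  calc _ ≤ ‖F x‖ * ‖outwardNormal K.carrier x‖ := norm_inner_le_norm _ _
    _ ≤ C := by rw [hn, mul_one]; exact hC x hx

end CurvilinearPolygon

/-! ### The divergence theorem -/

theorem divergence_eq_trace (F : Plane → Plane) (x : Plane) :
    divergence F x = LinearMap.trace ℝ Plane (fderiv ℝ F x : Plane →ₗ[ℝ] Plane) := by
  rw [LinearMap.trace_eq_sum_inner _ (EuclideanSpace.basisFun (Fin 2) ℝ), divergence]
  refine Finset.sum_congr rfl fun i _ => ?_
  simp [EuclideanSpace.inner_single_left]

/-- The divergence is the trace of the derivative, hence can be computed in the orthonormal frame of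
any chart. -/
theorem divergence_eq_rotated (e : Plane ≃ₗᵢ[ℝ] Plane) (F : Plane → Plane) (x : Plane) :
    divergence F x = ∑ i, e (fderiv ℝ F x (e.symm (EuclideanSpace.single i 1))) i := by
  rw [divergence_eq_trace,
    LinearMap.trace_eq_sum_inner _ ((EuclideanSpace.basisFun (Fin 2) ℝ).map e.symm)]
  refine Finset.sum_congr rfl fun i _ => ?_
  rw [← e.inner_map_map]
  simp [EuclideanSpace.inner_single_left]

theorem divergence_add {F G : Plane → Plane} {x : Plane} (hF : DifferentiableAt ℝ F x)
    (hG : DifferentiableAt ℝ G x) : divergence (F + G) x = divergence F x + divergence G x := by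
  simp [divergence, fderiv_add hF hG, Finset.sum_add_distrib]

theorem divergence_smul {φ : Plane → ℝ} {F : Plane → Plane} {x : Plane}
    (hφ : DifferentiableAt ℝ φ x) (hF : DifferentiableAt ℝ F x) :
    divergence (fun y => φ y • F y) x = φ x * divergence F x + ⟪F x, gradient φ x⟫ := by
  have h1 : ⟪F x, gradient φ x⟫ = fderiv ℝ φ x (F x) := by
    rw [real_inner_comm, gradient, InnerProductSpace.toDual_symm_apply]
  have h2 : fderiv ℝ φ x (F x) = ∑ i, F x i * fderiv ℝ φ x (EuclideanSpace.single i 1) := by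
    conv_lhs => rw [← (EuclideanSpace.basisFun (Fin 2) ℝ).sum_repr (F x)]
    simp
  rw [h1, h2]
  simp only [divergence, fderiv_fun_smul hφ hF]
  simp [Fin.sum_univ_two]
  ring

theorem continuous_divergence {F : Plane → Plane} (hF : ContDiff ℝ 1 F) :
    Continuous (divergence F) := by
  refine continuous_finsetSum _ fun i _ => ?_
  exact (EuclideanSpace.proj (𝕜 := ℝ) i).continuous.comp
    ((hF.continuous_fderiv one_ne_zero).clm_apply continuous_const)

theorem divergence_eq_zero_of_notMem_tsupport {F : Plane → Plane} {x : Plane}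
    (hx : x ∉ tsupport F) : divergence F x = 0 := by
  have : fderiv ℝ F x = 0 := by
    by_contra h
    exact hx (support_fderiv_subset ℝ (by simpa using h))
  simp [divergence, this]

theorem hasCompactSupport_divergence {F : Plane → Plane} (hF : HasCompactSupport F) :
    HasCompactSupport (divergence F) :=
  HasCompactSupport.intro hF.isCompact fun _ hx => divergence_eq_zero_of_notMem_tsupport hx

/-- Cartesian coordinates. -/
noncomputable def coordEquiv (e : Plane ≃ₗᵢ[ℝ] Plane) : Plane ≃L[ℝ] ℝ × ℝ :=
  (e.toContinuousLinearEquiv.trans (EuclideanSpace.equiv (Fin 2) ℝ)).trans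
    (ContinuousLinearEquiv.finTwoArrow ℝ ℝ)

theorem coordEquiv_apply (e : Plane ≃ₗᵢ[ℝ] Plane) (z : Plane) :
    coordEquiv e z = (e z 0, e z 1) := rfl

theorem measurePreserving_coordEquiv (e : Plane ≃ₗᵢ[ℝ] Plane) :
    MeasurePreserving (coordEquiv e) volume volume :=
  ((volume_preserving_finTwoArrow ℝ).comp (PiLp.volume_preserving_ofLp (Fin 2))).comp
    e.measurePreserving

namespace IsEpigraphOn

variable {K : CurvilinearPolygon} {B : Set Plane} {e : Plane ≃ₗᵢ[ℝ] Plane} {ψ : ℝ → ℝ} {L : NNReal}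

/-- The flux through the boundary of a field supported in a chart is the flux through the graph. -/
theorem integral_inner_outwardNormal (h : IsEpigraphOn K.carrier B e ψ L) {F : Plane → Plane}
    (hF : Continuous F) (hF' : HasCompactSupport F) (hFB : tsupport F ⊆ B) :
    ∫ x, ⟪F x, outwardNormal K.carrier x⟫ ∂K.ds =
      ∫ σ, (deriv ψ σ * e (F ((coordEquiv e).symm (σ, ψ σ))) 0 -
        e (F ((coordEquiv e).symm (σ, ψ σ))) 1) := by
  classical
  set f : ℝ → ℝ := fun σ => deriv ψ σ * e (F ((coordEquiv e).symm (σ, ψ σ))) 0 -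
        e (F ((coordEquiv e).symm (σ, ψ σ))) 1 with hf
  have hψc := h.lipschitz.continuous
  have hfi : Integrable f := by
    have hc : ∀ i, Continuous fun σ => e (F ((coordEquiv e).symm (σ, ψ σ))) i := fun i =>
      (continuous_coord e i).comp (hF.comp ((coordEquiv e).symm.continuous.comp (by fun_prop)))
    have hs : ∀ i, HasCompactSupport fun σ => e (F ((coordEquiv e).symm (σ, ψ σ))) i := fun i => by
      refine HasCompactSupport.of_support_subset_isCompact
        (hF'.isCompact.image (continuous_coord e 0)) fun σ hσ => ?_
      refine ⟨(coordEquiv e).symm (σ, ψ σ), subset_tsupport _ fun h0 => hσ ?_, ?_⟩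
      · simp [h0]
      · have := congrArg Prod.fst ((coordEquiv e).apply_symm_apply (σ, ψ σ))
        exact this
    have hi := fun i => (hc i).integrable_of_hasCompactSupport (μ := volume) (hs i)
    exact ((hi 0).bdd_mul (c := L) (measurable_deriv ψ).aestronglyMeasurable
      (ae_of_all _ fun p => norm_deriv_le_of_lipschitz h.lipschitz)).sub (hi 1)
  have hgraph : ∀ {x}, e x 1 = ψ (e x 0) → (coordEquiv e).symm (e x 0, ψ (e x 0)) = x := by
    intro x hx
    rw [← hx, ← coordEquiv_apply, ContinuousLinearEquiv.symm_apply_apply]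
  -- `U i` collects the parameters at which edge `i` lies in the chart, and `s i` is the horizontal
  -- coordinate there. A point of the graph is determined by this coordinate, so injectivity and
  -- disjointness of the edges pass to their projections, and the change of variables applies edge
  -- by edge.
  let U : Fin K.numEdges → Set ℝ := fun i => Ioo 0 1 ∩ K.edge i ⁻¹' B
  let s : Fin K.numEdges → ℝ → ℝ := fun i t => e (K.edge i t) 0
  have hU : ∀ i, MeasurableSet (U i) := fun i =>
    (((K.edge_continuousOn i).mono Ioo_subset_Icc_self).isOpen_inter_preimage isOpen_Ioo
      h.isOpen).measurableSet
  have hUg : ∀ {i t}, t ∈ U i → (coordEquiv e).symm (s i t, ψ (s i t)) = K.edge i t :=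
    fun ht => hgraph (h.eventually_edge_mem_graph ht.1 ht.2).self_of_nhds
  have hinj : ∀ i, InjOn (s i) (U i) := by
    intro i t ht t' ht' hs
    refine K.edge_injOn i ht.1 ht'.1 ?_
    rw [← hUg ht, ← hUg ht', hs]
  have hder : ∀ i, ∀ t ∈ U i,
      HasDerivAt (s i) (e (derivWithin (K.edge i) (Icc 0 1) t) 0) t := fun i t ht => by
    have h1 := e.toContinuousLinearEquiv.hasFDerivAt.comp_hasDerivAt t
      (K.edge_hasStrictDerivAt i ht.1).hasDerivAt
    exact (EuclideanSpace.proj (𝕜 := ℝ) 0).hasFDerivAt.comp_hasDerivAt t h1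
  have hV : ∀ i, MeasurableSet (s i '' U i) := fun i =>
    (hU i).image_of_continuousOn_injOn
      (fun t ht => (hder i t ht).continuousAt.continuousWithinAt) (hinj i)
  have hdisj : Pairwise (Function.onFun Disjoint fun i => s i '' U i) := by
    intro i j hij
    rw [Function.onFun, Set.disjoint_left]
    rintro _ ⟨t, ht, rfl⟩ ⟨t', ht', hs⟩
    refine Set.disjoint_left.1 (K.edge_disjoint i j hij) (mem_image_of_mem _ ht.1) ⟨t', ht'.1, ?_⟩
    rw [← hUg ht, ← hUg ht', hs]
  rw [K.integral_ds ((K.memLp_inner_outwardNormal hF 1).integrable le_rfl)]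
  have hedge : ∀ i, ∫ t in Ioo 0 1, K.speed i t *
      ⟪F (K.edge i t), outwardNormal K.carrier (K.edge i t)⟫ = ∫ σ in s i '' U i, f σ := by
    intro i
    rw [integral_image_eq_integral_abs_deriv_smul (hU i)
      (fun t ht => (hder i t ht).hasDerivWithinAt) (hinj i)]
    rw [← integral_indicator measurableSet_Ioo, ← integral_indicator (hU i)]
    congr 1
    ext t
    by_cases ht : t ∈ U i
    · rw [indicator_of_mem ht, indicator_of_mem ht.1, h.speed_mul_inner_outwardNormal ht.1 ht.2,
        smul_eq_mul]
      simp only [hf, hUg ht]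
      rfl
    · rw [indicator_of_notMem ht]
      by_cases ht' : t ∈ Ioo (0 : ℝ) 1
      · rw [indicator_of_mem ht', image_eq_zero_of_notMem_tsupport (f := F)]
        · simp
        · exact fun hB => ht ⟨ht', hFB hB⟩
      · rw [indicator_of_notMem ht']
  simp_rw [hedge]
  rw [← integral_iUnion_fintype hV hdisj fun i => hfi.integrableOn]
  rw [← integral_indicator (MeasurableSet.iUnion hV)]
  refine integral_congr_ae ?_
  -- The projections of the edges need not cover the line. A missed `σ` is either the projection of
  -- an end point of an edge, of which there are finitely many, or lies under a graph point outside
  -- `B`, where `F` vanishes.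
  have hfin : (⋃ i, ({s i 0, s i 1} : Set ℝ)).Finite := Set.finite_iUnion fun i => by simp
  filter_upwards [hfin.countable.ae_notMem volume] with σ hσ
  by_cases hσV : σ ∈ ⋃ i, s i '' U i
  · rw [indicator_of_mem hσV]
  rw [indicator_of_notMem hσV]
  set x := (coordEquiv e).symm (σ, ψ σ) with hx
  have hxc : (e x 0, e x 1) = (σ, ψ σ) := (coordEquiv e).apply_symm_apply (σ, ψ σ)
  have hx0 : e x 0 = σ := congrArg Prod.fst hxc
  have hx1 : e x 1 = ψ σ := congrArg Prod.snd hxc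
  have hxB : x ∉ B := by
    intro hxB
    have hfr := (h.mem_frontier_iff K.isOpen hxB).2 (by rw [hx0, hx1])
    rw [K.frontier_eq] at hfr
    obtain ⟨i, t, ht, hit⟩ := mem_iUnion.1 hfr
    have hst : s i t = σ := by rw [← hx0, ← hit]
    rcases eq_or_ne t 0 with rfl | h0
    · exact hσ (mem_iUnion.2 ⟨i, by simp [hst]⟩)
    rcases eq_or_ne t 1 with rfl | h1
    · exact hσ (mem_iUnion.2 ⟨i, by simp [hst]⟩)
    refine hσV (mem_iUnion.2 ⟨i, t, ⟨⟨lt_of_le_of_ne ht.1 h0.symm, lt_of_le_of_ne ht.2 h1⟩, ?_⟩, hst⟩)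
    rw [mem_preimage, hit]; exact hxB
  have hFx : F x = 0 := image_eq_zero_of_notMem_tsupport fun hB => hxB (hFB hB)
  simp [hFx]

/-- In chart coordinates this is `integral_epigraph` combined with the flux identity above. -/
theorem integral_divergence (h : IsEpigraphOn K.carrier B e ψ L) {F : Plane → Plane}
    (hF : ContDiff ℝ 1 F) (hF' : HasCompactSupport F) (hFB : tsupport F ⊆ B) :
    ∫ x in K.carrier, divergence F x = ∫ x, ⟪F x, outwardNormal K.carrier x⟫ ∂K.ds := by
  rw [h.integral_inner_outwardNormal hF.continuous hF' hFB]
  have hc : ∀ i, ContDiff ℝ 1 fun p => e (F ((coordEquiv e).symm p)) i := fun i =>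
    (EuclideanSpace.proj (𝕜 := ℝ) i).contDiff.comp (e.toContinuousLinearEquiv.contDiff.comp
      (hF.comp (coordEquiv e).symm.contDiff))
  have hs : ∀ i, HasCompactSupport fun p => e (F ((coordEquiv e).symm p)) i := fun i =>
    ((hF'.comp_homeomorph (coordEquiv e).symm.toHomeomorph).comp_left (g := fun y => e y i)
      (by simp))
  rw [← integral_epigraph h.lipschitz (hc 0) (hc 1) (hs 0) (hs 1),
    ← (measurePreserving_coordEquiv e).setIntegral_preimage_emb
      (coordEquiv e).toHomeomorph.measurableEmbedding]
  have hm : MeasurableSet (coordEquiv e ⁻¹' {p | ψ p.1 < p.2}) :=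
    ((isOpen_lt (h.lipschitz.continuous.comp continuous_fst) continuous_snd).preimage
      (coordEquiv e).continuous).measurableSet
  rw [← integral_indicator K.isOpen.measurableSet, ← integral_indicator hm]
  congr 1
  ext z
  have hd : ∀ i v, fderiv ℝ (fun p => e (F ((coordEquiv e).symm p)) i) (coordEquiv e z) v =
      e (fderiv ℝ F z ((coordEquiv e).symm v)) i := by
    intro i v
    have h1 : HasFDerivAt F (fderiv ℝ F z) ((coordEquiv e).symm (coordEquiv e z)) := by
      rw [ContinuousLinearEquiv.symm_apply_apply]
      exact (hF.differentiable one_ne_zero z).hasFDerivAt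
    have h2 := (EuclideanSpace.proj (𝕜 := ℝ) i).hasFDerivAt.comp (coordEquiv e z)
      (e.toContinuousLinearEquiv.hasFDerivAt.comp (coordEquiv e z)
        (h1.comp (coordEquiv e z) (coordEquiv e).symm.hasFDerivAt))
    exact congrArg (fun l => l v) h2.fderiv
  have hb : ∀ v : ℝ × ℝ, (coordEquiv e).symm v = e.symm !₂[v.1, v.2] := by
    intro v
    rw [ContinuousLinearEquiv.symm_apply_eq, coordEquiv_apply]
    simp
  have hdiv : divergence F z = fderiv ℝ (fun p => e (F ((coordEquiv e).symm p)) 0)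
      (coordEquiv e z) (1, 0) + fderiv ℝ (fun p => e (F ((coordEquiv e).symm p)) 1)
      (coordEquiv e z) (0, 1) := by
    have h0 : (!₂[1, 0] : Plane) = EuclideanSpace.single 0 1 := by
      ext i; fin_cases i <;> simp
    have h1 : (!₂[0, 1] : Plane) = EuclideanSpace.single 1 1 := by
      ext i; fin_cases i <;> simp
    rw [hd, hd, hb, hb, divergence_eq_rotated e, Fin.sum_univ_two, h0, h1]
  -- The domain and the epigraph coincide only inside `B`; elsewhere the divergence is zero because
  -- `F` is supported in `B`.
  by_cases hz : z ∈ B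
  · by_cases hzK : z ∈ K.carrier
    · have hz' : z ∈ coordEquiv e ⁻¹' {p | ψ p.1 < p.2} := (h.mem_iff z hz).1 hzK
      rw [indicator_of_mem hzK, indicator_of_mem hz', hdiv]
    · have hz' : z ∉ coordEquiv e ⁻¹' {p | ψ p.1 < p.2} := fun h' => hzK ((h.mem_iff z hz).2 h')
      rw [indicator_of_notMem hzK, indicator_of_notMem hz']
  · have h0 : divergence F z = 0 :=
      divergence_eq_zero_of_notMem_tsupport fun h' => hz (hFB h')
    rw [indicator_apply_eq_zero.2 fun _ => h0, indicator_apply_eq_zero.2 fun _ => hdiv ▸ h0]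

end IsEpigraphOn

theorem integral_divergence_eq_zero {F : Plane → Plane} (hF : ContDiff ℝ 1 F)
    (hF' : HasCompactSupport F) : ∫ x, divergence F x = 0 := by
  have hd : ∀ i : Fin 2, ∀ x, fderiv ℝ F x (EuclideanSpace.single i 1) i =
      fderiv ℝ (fun y => F y i) x (EuclideanSpace.single i 1) := fun i x => by
    have h := (EuclideanSpace.proj (𝕜 := ℝ) i).hasFDerivAt.comp x
      (hF.differentiable one_ne_zero x).hasFDerivAt
    exact (congrArg (fun l => l (EuclideanSpace.single i 1)) h.fderiv).symm
  have hc : ∀ i, ContDiff ℝ 1 fun y => F y i := fun i =>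
    (EuclideanSpace.proj (𝕜 := ℝ) i).contDiff.comp hF
  have hs : ∀ i, HasCompactSupport fun y => F y i := fun i =>
    hF'.comp_left (g := fun y : Plane => y i) (by simp)
  have hi : ∀ i v, Integrable fun y => fderiv ℝ (fun y => F y i) y v := fun i v =>
    (((hc i).continuous_fderiv one_ne_zero).clm_apply
      continuous_const).integrable_of_hasCompactSupport ((hs i).fderiv_apply ℝ v)
  simp only [divergence, hd]
  rw [integral_finsetSum _ fun i _ => hi i _]
  refine Finset.sum_eq_zero fun i _ => ?_
  have h := integral_mul_fderiv_eq_neg_fderiv_mul_of_integrable (μ := volume)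
    (f := fun _ : Plane => (1 : ℝ)) (g := fun y => F y i) (v := EuclideanSpace.single i 1)
    (by simp) (by simpa using hi i _)
    (by simpa using (hc i).continuous.integrable_of_hasCompactSupport (hs i))
    (fun x _ => differentiableAt_const _) (fun x _ => (hc i).differentiable one_ne_zero x)
  simpa using h

theorem divergence_congr {F G : Plane → Plane} {x : Plane} (h : F =ᶠ[𝓝 x] G) :
    divergence F x = divergence G x := by
  simp [divergence, h.fderiv_eq]

theorem divergence_sum {ι : Type*} (s : Finset ι) {F : ι → Plane → Plane} {x : Plane}
    (hF : ∀ i ∈ s, DifferentiableAt ℝ (F i) x) :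
    divergence (fun y => ∑ i ∈ s, F i y) x = ∑ i ∈ s, divergence (F i) x := by
  simp only [divergence]
  rw [Finset.sum_comm, fderiv_fun_sum hF]
  simp

namespace CurvilinearPolygon

variable (K : CurvilinearPolygon)

/-- A smooth partition of unity of the closure, subordinate to interior balls and charts. -/
theorem exists_partition : ∃ (s : Finset Plane) (χ : Plane → Plane → ℝ),
    (∀ x ∈ s, ContDiff ℝ ∞ (χ x) ∧ HasCompactSupport (χ x) ∧
      (tsupport (χ x) ⊆ K.carrier ∨ ∃ (e : Plane ≃ₗᵢ[ℝ] Plane) (ψ : ℝ → ℝ) (L : NNReal)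
        (B : Set Plane), IsEpigraphOn K.carrier B e ψ L ∧ tsupport (χ x) ⊆ B)) ∧
    ∀ y ∈ closure K.carrier, ∑ x ∈ s, χ x y = 1 := by
  have h : ∀ x ∈ closure K.carrier, ∃ r, 0 < r ∧ (Metric.ball x r ⊆ K.carrier ∨
      ∃ (e : Plane ≃ₗᵢ[ℝ] Plane) (ψ : ℝ → ℝ) (L : NNReal),
        IsEpigraphOn K.carrier (Metric.ball x r) e ψ L) := by
    intro x hx
    by_cases hxK : x ∈ K.carrier
    · obtain ⟨r, hr, hrK⟩ := Metric.isOpen_iff.1 K.isOpen x hxK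
      exact ⟨r, hr, Or.inl hrK⟩
    · have hfr : x ∈ frontier K.carrier := by rw [K.isOpen.frontier_eq]; exact ⟨hx, hxK⟩
      obtain ⟨e, ψ, L, ε, hε, h⟩ := K.exists_chart hfr
      exact ⟨ε, hε, Or.inr ⟨e, ψ, L, h⟩⟩
  choose! r hr hr' using h
  obtain ⟨s, χ, h1, h2, h3⟩ := exists_smooth_partition K.isCompact_closure r hr
  refine ⟨s, χ, fun x hx => ⟨(h2 x hx).1, (h2 x hx).2.1, ?_⟩, h3⟩
  rcases hr' x (h1 x hx) with h | ⟨e, ψ, L, h⟩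
  · exact Or.inl ((h2 x hx).2.2.trans h)
  · exact Or.inr ⟨e, ψ, L, _, h, (h2 x hx).2.2⟩

theorem integrableOn_of_continuous {E : Type*} [NormedAddCommGroup E] {f : Plane → E}
    (hf : Continuous f) : IntegrableOn f K.carrier :=
  (hf.continuousOn.integrableOn_compact K.isCompact_closure).mono_set subset_closure

theorem integral_divergence_of_tsupport_subset {F : Plane → Plane} (hF : ContDiff ℝ 1 F)
    (hF' : HasCompactSupport F) (hFK : tsupport F ⊆ K.carrier) :
    ∫ x in K.carrier, divergence F x = 0 := by
  rw [setIntegral_eq_integral_of_forall_compl_eq_zero, integral_divergence_eq_zero hF hF']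
  exact fun x hx => divergence_eq_zero_of_notMem_tsupport fun h => hx (hFK h)

/-- The divergence theorem. -/
theorem integral_divergence {F : Plane → Plane} (hF : ContDiff ℝ 1 F) :
    ∫ x in K.carrier, divergence F x = ∫ x, ⟪F x, outwardNormal K.carrier x⟫ ∂K.ds := by
  obtain ⟨s, χ, hχ, hsum⟩ := K.exists_partition
  have hc : ∀ z ∈ s, ContDiff ℝ 1 fun y => χ z y • F y := fun z hz =>
    ((hχ z hz).1.of_le (by simp)).smul hF
  have hs : ∀ z ∈ s, HasCompactSupport fun y => χ z y • F y := fun z hz =>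
    (hχ z hz).2.1.smul_right
  have hsub : ∀ z ∈ s, tsupport (fun y => χ z y • F y) ⊆ tsupport (χ z) := fun z _ =>
    tsupport_smul_subset_left _ _
  have hF1 : ∀ y ∈ closure K.carrier, F y = ∑ z ∈ s, χ z y • F y := fun y hy => by
    rw [← Finset.sum_smul, hsum y hy, one_smul]
  have hL : ∫ x in K.carrier, divergence F x =
      ∑ z ∈ s, ∫ x in K.carrier, divergence (fun y => χ z y • F y) x := by
    rw [← integral_finsetSum s fun z hz =>
      K.integrableOn_of_continuous (continuous_divergence (hc z hz))]
    refine setIntegral_congr_fun K.isOpen.measurableSet fun x hx => ?_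
    beta_reduce
    rw [← divergence_sum s fun z hz => (hc z hz).differentiable one_ne_zero x]
    -- The cutoffs sum to one only on the closure; openness of the domain makes the identity hold
    -- near `x`, so it may be differentiated.
    refine divergence_congr ?_
    filter_upwards [K.isOpen.mem_nhds hx] with y hy using hF1 y (subset_closure hy)
  have hR : ∫ x, ⟪F x, outwardNormal K.carrier x⟫ ∂K.ds =
      ∑ z ∈ s, ∫ x, ⟪χ z x • F x, outwardNormal K.carrier x⟫ ∂K.ds := by
    rw [← integral_finsetSum s fun z hz =>
      (K.memLp_inner_outwardNormal (hc z hz).continuous 1).integrable le_rfl]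
    refine integral_congr_ae ?_
    filter_upwards [K.ae_mem_frontier] with x hx
    rw [← sum_inner, ← hF1 x (frontier_subset_closure hx)]
  rw [hL, hR]
  refine Finset.sum_congr rfl fun z hz => ?_
  -- Pieces supported inside the domain contribute zero to both sides; the others are handled in
  -- their chart.
  rcases (hχ z hz).2.2 with hK | ⟨e, ψ, L, B, h, hB⟩
  · rw [K.integral_divergence_of_tsupport_subset (hc z hz) (hs z hz) ((hsub z hz).trans hK)]
    refine (integral_eq_zero_of_ae ?_).symm
    filter_upwards [K.ae_mem_frontier] with x hx
    rw [K.isOpen.frontier_eq] at hx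
    rw [image_eq_zero_of_notMem_tsupport (f := χ z) fun h => hx.2 (hK h), zero_smul,
      inner_zero_left]
    rfl
  · exact h.integral_divergence (hc z hz) (hs z hz) ((hsub z hz).trans hB)

end CurvilinearPolygon

/-! ### Translation and mollification of square integrable functions -/

section Translation

variable {W : Type*} [NormedAddCommGroup W] [InnerProductSpace ℝ W]

/-- Translations act continuously on `L²`. This is what permits the translation vector to tend to
zero in the density argument. -/
theorem continuous_integral_inner_translate {f g : Plane → W} (hf : MemLp f 2) (hg : MemLp g 2) :
    Continuous fun y : Plane => ∫ x, ⟪f (x - y), g x⟫ := by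
  have : Fact ((2 : ENNReal) ≠ ⊤) := ⟨by simp⟩
  have h1 : ∀ y : Plane, ∫ x, ⟪f (x - y), g x⟫ =
      ⟪DomAddAct.mk (-y) +ᵥ hf.toLp f, hg.toLp g⟫ := by
    intro y
    rw [L2.inner_def]
    refine integral_congr_ae ?_
    filter_upwards [DomAddAct.vadd_Lp_ae_eq (DomAddAct.mk (-y)) (hf.toLp f), hg.coeFn_toLp,
      (measurePreserving_vadd (-y) (volume : Measure Plane)).quasiMeasurePreserving.ae
        hf.coeFn_toLp] with x h2 h3 h4
    rw [h2, h3]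
    simp only [Equiv.symm_apply_apply]
    rw [h4, vadd_eq_add, neg_add_eq_sub]
  simp_rw [h1]
  have h2 : Continuous fun y : Plane => DomAddAct.mk (-y) +ᵥ hf.toLp f :=
    (DomAddAct.continuous_mk.comp continuous_neg).vadd continuous_const
  exact h2.inner continuous_const

theorem integrable_inner_of_memLp {α : Type*} [MeasurableSpace α] {μ : Measure α} {f g : α → W}
    (hf : MemLp f 2 μ) (hg : MemLp g 2 μ) : Integrable (fun x => ⟪f x, g x⟫) μ :=
  (hf.norm.integrable_mul hg.norm).mono' (hf.aestronglyMeasurable.inner hg.aestronglyMeasurable)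
    (ae_of_all _ fun _ => norm_inner_le_norm _ _)

theorem integrable_mul_of_memLp {α : Type*} [MeasurableSpace α] {μ : Measure α} {f g : α → ℝ}
    (hf : MemLp f 2 μ) (hg : MemLp g 2 μ) : Integrable (fun x => f x * g x) μ :=
  hf.integrable_mul hg

/-- By Fubini, averaging the pairings with translates of `f` is the pairing with a mollification of
`f`. Statements about smooth mollifications thus become statements about translates. -/
theorem integral_mollify_inner [CompleteSpace W] {f g : Plane → W} (hf : MemLp f 2)
    (hg : MemLp g 2) {κ : Plane → ℝ} (hκ : Continuous κ) (hκ' : HasCompactSupport κ) :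
    ∫ y, κ y * ∫ x, ⟪f (x - y), g x⟫ = ∫ x, ⟪∫ t, κ (x - t) • f t, g x⟫ := by
  have hfy : ∀ y : Plane, MemLp (fun x => f (x - y)) 2 := fun y =>
    hf.comp_measurePreserving (measurePreserving_sub_right volume y)
  have hm : AEStronglyMeasurable (fun p : Plane × Plane => κ p.1 * ⟪f (p.2 - p.1), g p.2⟫)
      (volume.prod volume) := by
    have h1 : AEStronglyMeasurable (fun p : Plane × Plane => f (p.2 - p.1)) (volume.prod volume) :=
      hf.aestronglyMeasurable.comp_quasiMeasurePreserving
        ((quasiMeasurePreserving_sub volume volume).comp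
          Measure.measurePreserving_swap.quasiMeasurePreserving)
    exact (hκ.comp continuous_fst).aestronglyMeasurable.mul
      (h1.inner (hg.aestronglyMeasurable.comp_snd))
  -- Translation invariance bounds the inner integral uniformly in `y`, so `|κ y|` times a constant
  -- is an integrable majorant for Fubini.
  have hbd : ∀ y, ∫ x, ‖κ y * ⟪f (x - y), g x⟫‖ ≤
      |κ y| * ((∫ x, ‖f x‖ ^ 2) + ∫ x, ‖g x‖ ^ 2) := by
    intro y
    simp_rw [norm_mul, integral_const_mul]
    refine mul_le_mul_of_nonneg_left ?_ (norm_nonneg _)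
    have hf2 : Integrable fun x => ‖f (x - y)‖ ^ 2 := (hfy y).integrable_norm_pow (by simp)
    have hg2 : Integrable fun x => ‖g x‖ ^ 2 := hg.integrable_norm_pow (by simp)
    rw [← integral_sub_right_eq_self (fun x => ‖f x‖ ^ 2) y, ← integral_add hf2 hg2]
    refine integral_mono (integrable_inner_of_memLp (hfy y) hg).norm (hf2.add hg2) fun x => ?_
    refine (norm_inner_le_norm _ _).trans ?_
    change _ ≤ ‖f (x - y)‖ ^ 2 + ‖g x‖ ^ 2
    nlinarith [sq_nonneg (‖f (x - y)‖ - ‖g x‖), sq_nonneg (‖f (x - y)‖), sq_nonneg ‖g x‖]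
  have hint : Integrable (Function.uncurry fun y x : Plane => κ y * ⟪f (x - y), g x⟫)
      (volume.prod volume) := by
    refine (integrable_prod_iff hm).2 ⟨ae_of_all _ fun y => ?_, ?_⟩
    · exact (integrable_inner_of_memLp (hfy y) hg).const_mul (κ y)
    · refine ((hκ.abs.integrable_of_hasCompactSupport hκ'.norm).mul_const
        ((∫ x, ‖f x‖ ^ 2) + ∫ x, ‖g x‖ ^ 2)).mono' hm.norm.integral_prod_right' ?_
      refine ae_of_all _ fun y => ?_
      rw [Real.norm_of_nonneg (integral_nonneg fun _ => norm_nonneg _)]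
      exact hbd y
  simp_rw [← integral_const_mul]
  rw [integral_integral_swap hint]
  refine integral_congr_ae (ae_of_all _ fun x => ?_)
  beta_reduce
  have hi : Integrable fun t => κ (x - t) • f t := by
    have h1 : LocallyIntegrable f := hf.locallyIntegrable one_le_two
    refine h1.integrable_smul_left_of_hasCompactSupport (by fun_prop) ?_
    exact hκ'.comp_homeomorph (Homeomorph.subLeft x)
  rw [← integral_sub_left_eq_self _ volume x, real_inner_comm, ← integral_inner hi]
  refine integral_congr_ae (ae_of_all _ fun t => ?_)
  simp [real_inner_smul_right, real_inner_comm (g x)]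

end Translation

/-! ### Weak gradients and divergences, mollification, and translation into the domain -/

theorem gradient_apply (f : Plane → ℝ) (x : Plane) (i : Fin 2) :
    gradient f x i = fderiv ℝ f x (EuclideanSpace.single i 1) := by
  have h : ⟪gradient f x, EuclideanSpace.single i 1⟫ =
      fderiv ℝ f x (EuclideanSpace.single i 1) := by
    rw [gradient, InnerProductSpace.toDual_symm_apply]
  rw [← h, real_inner_comm, EuclideanSpace.inner_single_left]
  simp

theorem inner_gradient (f : Plane → ℝ) (x v : Plane) : ⟪v, gradient f x⟫ = fderiv ℝ f x v := by
  rw [real_inner_comm, gradient, InnerProductSpace.toDual_symm_apply]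

theorem ContDiff.gradient {f : Plane → ℝ} (hf : ContDiff ℝ ∞ f) : ContDiff ℝ ∞ (gradient f) := by
  rw [contDiff_euclidean]
  intro i
  simp_rw [gradient_apply]
  exact (hf.fderiv_right (m := ∞) (by simp)).clm_apply contDiff_const

theorem divergence_smul_const {φ : Plane → ℝ} {x : Plane} (hφ : DifferentiableAt ℝ φ x)
    (v : Plane) : divergence (fun y => φ y • v) x = fderiv ℝ φ x v := by
  rw [divergence_smul hφ (differentiableAt_const v), inner_gradient]
  simp [divergence]

/-- `E` is the weak gradient of `h` in the whole plane. -/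
def IsGlobalWeakGradient (h : Plane → ℝ) (E : Plane → Plane) : Prop :=
  ∀ F, ContDiff ℝ ∞ F → HasCompactSupport F → ∫ x, h x * divergence F x = -∫ x, ⟪E x, F x⟫

/-- `d` is the weak divergence of `G` in `Ω`. -/
def IsWeakDivergence (Ω : Set Plane) (G : Plane → Plane) (d : Plane → ℝ) : Prop :=
  ∀ φ, IsTestFunction Ω φ → ∫ x in Ω, ⟪G x, gradient φ x⟫ = -∫ x in Ω, d x * φ x

/-- The derivative of the convolution falls on the kernel; testing the weak gradient with the field
`κ (x - ·) v` moves it to `h`. The sign from the reflection `x - t` cancels the sign of the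
integration by parts. -/
theorem IsGlobalWeakGradient.hasGradientAt_mollify {h : Plane → ℝ} {E : Plane → Plane}
    (hE : IsGlobalWeakGradient h E) (hh : LocallyIntegrable h) (hE' : LocallyIntegrable E)
    {κ : Plane → ℝ} (hκ : ContDiff ℝ ∞ κ) (hκ' : HasCompactSupport κ) :
    ContDiff ℝ ∞ (fun x => ∫ t, κ (x - t) • h t) ∧
      ∀ x, gradient (fun x => ∫ t, κ (x - t) • h t) x = ∫ t, κ (x - t) • E t := by
  have heq : (fun x => ∫ t, κ (x - t) • h t) =
      convolution h κ (ContinuousLinearMap.lsmul ℝ ℝ) volume := by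
    ext x
    simp [convolution, mul_comm]
  rw [heq]
  refine ⟨hκ'.contDiff_convolution_right _ hh hκ, fun x => ?_⟩
  have hd := hκ'.hasFDerivAt_convolution_right (ContinuousLinearMap.lsmul ℝ ℝ) hh
    (hκ.of_le (by simp)) x
  refine ext_inner_left ℝ fun v => ?_
  have hi : Integrable fun t => κ (x - t) • E t :=
    hE'.integrable_smul_left_of_hasCompactSupport (hκ.continuous.comp (by fun_prop))
      (hκ'.comp_homeomorph (Homeomorph.subLeft x))
  rw [inner_gradient, hd.fderiv, convolution_precompR_apply _ hh (hκ'.fderiv ℝ)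
    (hκ.continuous_fderiv (by simp)), ← integral_inner hi]
  have hsub : ContDiff ℝ ∞ fun t => κ (x - t) := hκ.comp (contDiff_const.sub contDiff_id)
  have h1 := hE (fun t => κ (x - t) • v) (hsub.smul contDiff_const)
    (hκ'.comp_homeomorph (Homeomorph.subLeft x)).smul_right
  have h2 : ∀ t, divergence (fun t => κ (x - t) • v) t = -fderiv ℝ κ (x - t) v := by
    intro t
    rw [divergence_smul_const (hsub.differentiable (by simp) t)]
    have h3 := (hκ.differentiable (by simp) (x - t)).hasFDerivAt.comp t
      ((hasFDerivAt_id (𝕜 := ℝ) t).const_sub x)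
    have h4 := congrArg (fun l => l v) h3.fderiv
    simpa [Function.comp_def] using h4
  simp_rw [h2, mul_neg, integral_neg, neg_inj] at h1
  simp only [convolution, ContinuousLinearMap.lsmul_apply, smul_eq_mul]
  rw [h1]
  refine integral_congr_ae (ae_of_all _ fun t => ?_)
  simp [real_inner_smul_right, real_inner_comm]

open scoped Pointwise in
/-- Integration by parts against a field with weak divergence, for functions which can be
translated into the domain. -/
theorem integral_eq_zero_of_translate {Ω Z : Set Plane} (hΩ : IsOpen Ω) (hZ : IsCompact Z)
    {h : Plane → ℝ} {E : Plane → Plane} (hh : MemLp h 2) (hE : MemLp E 2)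
    (hhE : IsGlobalWeakGradient h E) (hhZ : ∀ x ∉ Z, h x = 0)
    {G : Plane → Plane} {d : Plane → ℝ} (hG : MemLp G 2 (volume.restrict Ω))
    (hd : MemLp d 2 (volume.restrict Ω)) (hGd : IsWeakDivergence Ω G d)
    (hcl : (0 : Plane) ∈ closure {y | ∀ z ∈ Z, z + y ∈ Ω}) :
    ∫ x in Ω, (⟪E x, G x⟫ + h x * d x) = 0 := by
  set O : Set Plane := {y | ∀ z ∈ Z, z + y ∈ Ω} with hO
  -- A translate of the compact set `Z` inside the open set `Ω` keeps a positive distance from the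
  -- complement.
  have hOo : IsOpen O := by
    rw [isOpen_iff_mem_nhds]
    intro y hy
    have hZy : IsCompact ((· + y) '' Z) := hZ.image (by fun_prop)
    obtain ⟨δ, hδ, hs⟩ := hZy.exists_thickening_subset_open hΩ (by rintro _ ⟨z, hz, rfl⟩; exact hy z hz)
    filter_upwards [Metric.ball_mem_nhds y hδ] with y' hy' z hz
    refine hs (Metric.mem_thickening_iff.2 ⟨z + y, mem_image_of_mem _ hz, ?_⟩)
    simpa using hy'
  set G' := Ω.indicator G
  set d' := Ω.indicator d
  have hG' : MemLp G' 2 := (memLp_indicator_iff_restrict hΩ.measurableSet).2 hG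
  have hd' : MemLp d' 2 := (memLp_indicator_iff_restrict hΩ.measurableSet).2 hd
  -- `A y` is the desired pairing after `h` and `E` are translated by `y`; the claim is `A 0 = 0`.
  set A : Plane → ℝ := fun y => (∫ x, ⟪E (x - y), G' x⟫) + ∫ x, ⟪h (x - y), d' x⟫ with hA
  have hAc : Continuous A :=
    (continuous_integral_inner_translate hE hG').add (continuous_integral_inner_translate hh hd')
  -- For a kernel supported in `O`, the mollification of `h` is supported in `Z + tsupport κ ⊆ Ω`.
  -- It is an admissible test function for the weak divergence, and Fubini identifies the result
  -- with the integral of `κ A`.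
  have hA0 : ∀ᵐ y, y ∈ O → A y = 0 := by
    refine IsOpen.ae_eq_zero_of_integral_contDiff_smul_eq_zero hOo
      (hAc.locallyIntegrable.locallyIntegrableOn _) fun κ hκ hκ' hκO => ?_
    obtain ⟨h1, h2⟩ := hhE.hasGradientAt_mollify (hh.locallyIntegrable one_le_two)
      (hE.locallyIntegrable one_le_two) hκ hκ'
    set φ : Plane → ℝ := fun x => ∫ t, κ (x - t) • h t with hφ
    have hsub : Function.support φ ⊆ Z + tsupport κ := by
      intro x hx
      by_contra hxn
      apply hx
      refine integral_eq_zero_of_ae (ae_of_all _ fun t => ?_)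
      by_cases ht : t ∈ Z
      · have : κ (x - t) = 0 := image_eq_zero_of_notMem_tsupport fun h' =>
          hxn (Set.mem_add.2 ⟨t, ht, x - t, h', by abel⟩)
        simp [this]
      · simp [hhZ t ht]
    have hcpt : IsCompact (Z + tsupport κ) := hZ.add hκ'.isCompact
    have htest : IsTestFunction Ω φ := by
      refine ⟨h1, HasCompactSupport.of_support_subset_isCompact hcpt hsub,
        (closure_minimal hsub hcpt.isClosed).trans ?_⟩
      intro x hx
      obtain ⟨z, hz, y, hy, rfl⟩ := Set.mem_add.1 hx
      exact hκO hy z hz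
    have h3 := hGd φ htest
    have hi1 : Integrable fun y => κ y * ∫ x, ⟪E (x - y), G' x⟫ :=
      (hκ.continuous.mul (continuous_integral_inner_translate hE
        hG')).integrable_of_hasCompactSupport hκ'.mul_right
    have hi2 : Integrable fun y => κ y * ∫ x, ⟪h (x - y), d' x⟫ :=
      (hκ.continuous.mul (continuous_integral_inner_translate hh
        hd')).integrable_of_hasCompactSupport hκ'.mul_right
    simp only [hA, smul_eq_mul, mul_add]
    rw [integral_add hi1 hi2, integral_mollify_inner hE hG' hκ.continuous hκ',
      integral_mollify_inner hh hd' hκ.continuous hκ']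
    simp_rw [← h2]
    have e1 : ∫ x, ⟪gradient φ x, G' x⟫ = ∫ x in Ω, ⟪G x, gradient φ x⟫ := by
      rw [← integral_indicator hΩ.measurableSet]
      congr 1; ext x
      by_cases hx : x ∈ Ω <;> simp [G', hx]
    have e2 : ∫ x, ⟪φ x, d' x⟫ = ∫ x in Ω, d x * φ x := by
      rw [← integral_indicator hΩ.measurableSet]
      congr 1; ext x
      by_cases hx : x ∈ Ω <;> simp [d', hx]
    have e2' : ∫ x, ⟪∫ t, κ (x - t) • h t, d' x⟫ = ∫ x in Ω, d x * φ x := e2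
    rw [e1, e2', h3]; ring
  -- A continuous function vanishing almost everywhere on an open set vanishes on it, since a null
  -- open set is empty.
  have hAO : ∀ y ∈ O, A y = 0 := by
    intro y hy
    by_contra hne
    have hU : IsOpen (O ∩ A ⁻¹' {0}ᶜ) := hOo.inter (isOpen_compl_singleton.preimage hAc)
    have hnull : volume (O ∩ A ⁻¹' {0}ᶜ) = 0 := by
      rw [ae_iff] at hA0
      refine measure_mono_null (fun x hx => ?_) hA0
      simpa using hx
    exact notMem_empty y ((hU.measure_eq_zero_iff volume).1 hnull ▸ ⟨hy, hne⟩)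
  have h0 : A 0 = 0 :=
    closure_minimal (fun y hy => hAO y hy) (isClosed_singleton.preimage hAc) hcl
  have hr : ∀ x, Ω.indicator (fun x => ⟪E x, G x⟫ + h x * d x) x = ⟪E x, G' x⟫ + ⟪h x, d' x⟫ := by
    intro x
    by_cases hx : x ∈ Ω <;> simp [G', d', hx, mul_comm]
  rw [← integral_indicator hΩ.measurableSet]
  simp_rw [hr]
  rw [integral_add (integrable_inner_of_memLp hE hG') (integrable_inner_of_memLp hh hd')]
  simpa [hA] using h0

/-! ### Density of smooth fields in `H(div; K)` -/

/-- This is the product rule, obtained by putting the cutoff on the test field. It localises the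
zero extension to one chart. -/
theorem IsGlobalWeakGradient.smul {h : Plane → ℝ} {E : Plane → Plane}
    (hE : IsGlobalWeakGradient h E) (hh : MemLp h 2) (hE' : MemLp E 2) {χ : Plane → ℝ}
    (hχ : ContDiff ℝ ∞ χ) (hχ' : HasCompactSupport χ) :
    MemLp (fun x => χ x * h x) 2 ∧ MemLp (fun x => χ x • E x + h x • gradient χ x) 2 ∧
      IsGlobalWeakGradient (fun x => χ x * h x) (fun x => χ x • E x + h x • gradient χ x) := by
  have hg : Continuous (gradient χ) := hχ.gradient.continuous
  have hgs : HasCompactSupport (gradient χ) :=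
    (hχ'.fderiv ℝ).comp_left (g := (InnerProductSpace.toDual ℝ Plane).symm) (map_zero _)
  obtain ⟨C, hC⟩ := hχ.continuous.bounded_above_of_compact_support hχ'
  obtain ⟨D, hD⟩ := hg.bounded_above_of_compact_support hgs
  have hm1 : MemLp (fun x => χ x * h x) 2 :=
    (hh.const_mul C).of_le (hχ.continuous.aestronglyMeasurable.mul hh.aestronglyMeasurable)
      (ae_of_all _ fun x => by
        rw [norm_mul, norm_mul]
        exact mul_le_mul_of_nonneg_right ((hC x).trans (le_abs_self C)) (norm_nonneg _))
  have hm2 : MemLp (fun x => χ x • E x) 2 :=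
    (hE'.const_smul C).of_le (hχ.continuous.aestronglyMeasurable.smul hE'.aestronglyMeasurable)
      (ae_of_all _ fun x => by
        rw [Pi.smul_apply, norm_smul, norm_smul]
        exact mul_le_mul_of_nonneg_right ((hC x).trans (le_abs_self C)) (norm_nonneg _))
  have hm3 : MemLp (fun x => h x • gradient χ x) 2 :=
    (hh.const_mul D).of_le (hh.aestronglyMeasurable.smul hg.aestronglyMeasurable)
      (ae_of_all _ fun x => by
        rw [norm_smul, norm_mul, mul_comm]
        exact mul_le_mul_of_nonneg_right ((hD x).trans (le_abs_self D)) (norm_nonneg _))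
  refine ⟨hm1, hm2.add hm3, fun F hF hF' => ?_⟩
  have hχF : ContDiff ℝ ∞ fun x => χ x • F x := hχ.smul hF
  have hχF' : HasCompactSupport fun x => χ x • F x := hχ'.smul_right
  have h1 := hE _ hχF hχF'
  have hFm : MemLp F 2 := hF.continuous.memLp_of_hasCompactSupport hF'
  have hi1 : Integrable fun x => h x * divergence (fun x => χ x • F x) x := by
    refine integrable_mul_of_memLp hh ?_
    exact (continuous_divergence (hχF.of_le (by simp))).memLp_of_hasCompactSupport
      (hasCompactSupport_divergence hχF')
  have hi2 := integrable_inner_of_memLp hm3 hFm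
  have hi3 := integrable_inner_of_memLp hm2 hFm
  have e1 : ∀ x, χ x * h x * divergence F x =
      h x * divergence (fun x => χ x • F x) x - ⟪h x • gradient χ x, F x⟫ := by
    intro x
    rw [divergence_smul (hχ.differentiable (by simp) x) (hF.differentiable (by simp) x),
      real_inner_smul_left, real_inner_comm]
    ring
  simp_rw [e1, inner_add_left]
  rw [integral_sub hi1 hi2, integral_add hi3 hi2, h1]
  have e2 : ∀ x, ⟪E x, χ x • F x⟫ = ⟪χ x • E x, F x⟫ := fun x => by
    rw [real_inner_smul_left, real_inner_smul_right]
  simp_rw [e2]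
  ring

/-- A compact part of the closed epigraph can be translated into the open epigraph. -/
theorem IsEpigraphOn.zero_mem_closure_translate {K B : Set Plane} {e : Plane ≃ₗᵢ[ℝ] Plane}
    {ψ : ℝ → ℝ} {L : NNReal} (h : IsEpigraphOn K B e ψ L) {Z : Set Plane} (hZ : IsCompact Z)
    (hZB : Z ⊆ B) (hZK : Z ⊆ closure K) : (0 : Plane) ∈ closure {y | ∀ z ∈ Z, z + y ∈ K} := by
  obtain ⟨δ, hδ, hs⟩ := hZ.exists_thickening_subset_open h.isOpen hZB
  have htend : Tendsto (fun s : ℝ => s • e.symm !₂[0, 1]) (𝓝[>] 0) (𝓝 0) := by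
    have h4 : Tendsto (fun s : ℝ => s • e.symm !₂[0, 1]) (𝓝 0)
        (𝓝 ((0 : ℝ) • e.symm !₂[0, 1])) := Continuous.tendsto (by fun_prop) 0
    rw [zero_smul] at h4
    exact h4.mono_left nhdsWithin_le_nhds
  refine mem_closure_of_tendsto htend ?_
  filter_upwards [htend.eventually (Metric.ball_mem_nhds 0 hδ), self_mem_nhdsWithin] with s hs1 hs0
  intro z hz
  have hzB : z + s • e.symm !₂[0, 1] ∈ B := by
    refine hs (Metric.mem_thickening_iff.2 ⟨z, hz, ?_⟩)
    simpa using hs1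
  rw [h.mem_iff _ hzB]
  have h1 := h.coord_le (hZB hz) (hZK hz)
  have h2 : (0 : ℝ) < s := hs0
  simp
  linarith

namespace CurvilinearPolygon

variable (K : CurvilinearPolygon)

theorem _root_.Continuous.memLp_carrier {E : Type*} [NormedAddCommGroup E]
    [SecondCountableTopology E] {F : Plane → E}
    (hF : Continuous F) (K : CurvilinearPolygon) (p : ENNReal) :
    MemLp F p (volume.restrict K.carrier) := by
  obtain ⟨C, hC⟩ := K.isCompact_closure.exists_bound_of_continuousOn hF.continuousOn
  have : IsFiniteMeasure (volume.restrict K.carrier) :=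
    ⟨by rw [Measure.restrict_apply_univ]; exact K.isBounded.measure_lt_top⟩
  exact MemLp.of_bound hF.aestronglyMeasurable C
    ((ae_restrict_mem K.isOpen.measurableSet).mono fun x hx => hC x (subset_closure hx))

/-- A pair orthogonal to all smooth fields and their divergences is orthogonal to `H(div; K)`. -/
theorem integral_eq_zero_of_orthogonal {E G : Plane → Plane} {h d : Plane → ℝ}
    (hE : MemLp E 2 (volume.restrict K.carrier)) (hh : MemLp h 2 (volume.restrict K.carrier))
    (horth : ∀ F, ContDiff ℝ ∞ F → ∫ x in K.carrier, (⟪E x, F x⟫ + h x * divergence F x) = 0)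
    (hG : MemLp G 2 (volume.restrict K.carrier)) (hd : MemLp d 2 (volume.restrict K.carrier))
    (hGd : IsWeakDivergence K.carrier G d) :
    ∫ x in K.carrier, (⟪E x, G x⟫ + h x * d x) = 0 := by
  have hKm := K.isOpen.measurableSet
  obtain ⟨s, χ, hχ, hsum⟩ := K.exists_partition
  set E' := K.carrier.indicator E
  set h' := K.carrier.indicator h
  have hE' : MemLp E' 2 := (memLp_indicator_iff_restrict hKm).2 hE
  have hh' : MemLp h' 2 := (memLp_indicator_iff_restrict hKm).2 hh
  -- Orthogonality holds against fields that need not vanish at the boundary, so it survives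
  -- extension by zero: no boundary term appears, and `h` behaves like an element of `H¹₀`.
  have hw : IsGlobalWeakGradient h' E' := by
    intro F hF hF'
    have hFm : MemLp F 2 := hF.continuous.memLp_of_hasCompactSupport hF'
    have hFd : MemLp (divergence F) 2 :=
      (continuous_divergence (hF.of_le (by simp))).memLp_of_hasCompactSupport
        (hasCompactSupport_divergence hF')
    have h1 := horth F hF
    rw [← integral_indicator hKm] at h1
    have h2 : ∀ x, K.carrier.indicator (fun x => ⟪E x, F x⟫ + h x * divergence F x) x =
        ⟪E' x, F x⟫ + h' x * divergence F x := by
      intro x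
      by_cases hx : x ∈ K.carrier <;> simp [E', h', hx]
    simp_rw [h2] at h1
    rw [integral_add (integrable_inner_of_memLp hE' hFm) (integrable_mul_of_memLp hh' hFd)] at h1
    linarith
  have hz : ∀ z ∈ s, ∫ x in K.carrier,
      (⟪χ z x • E' x + h' x • gradient (χ z) x, G x⟫ + χ z x * h' x * d x) = 0 := by
    intro z hz
    obtain ⟨h1, h2, h3⟩ := hw.smul hh' hE' (hχ z hz).1 (hχ z hz).2.1
    have hZ : IsCompact (closure K.carrier ∩ tsupport (χ z)) :=
      K.isCompact_closure.inter_right (isClosed_tsupport _)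
    refine integral_eq_zero_of_translate K.isOpen hZ h1 h2 h3 ?_ hG hd hGd ?_
    · intro x hx
      by_cases hxK : x ∈ K.carrier
      · rw [image_eq_zero_of_notMem_tsupport (f := χ z) fun hx' =>
          hx ⟨subset_closure hxK, hx'⟩, zero_mul]
      · simp [h', hxK]
    -- For an interior piece the zero translation already works; for a boundary piece one moves
    -- along the vertical axis of the chart.
    · rcases (hχ z hz).2.2 with hK | ⟨e, ψ, L, B, hB, hsub⟩
      · exact subset_closure fun x hx => by rw [add_zero]; exact hK hx.2
      · exact hB.zero_mem_closure_translate hZ (inter_subset_right.trans hsub) inter_subset_left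
  have hsum0 : ∑ z ∈ s, ∫ x in K.carrier,
      (⟪χ z x • E' x + h' x • gradient (χ z) x, G x⟫ + χ z x * h' x * d x) = 0 :=
    Finset.sum_eq_zero hz
  rw [← integral_finsetSum] at hsum0
  · rw [← hsum0]
    refine setIntegral_congr_fun hKm fun x hx => ?_
    beta_reduce
    -- The cutoffs sum to one near `x`, so their gradients cancel and the localised identities add
    -- up to the original one.
    have hgr : ∑ z ∈ s, gradient (χ z) x = 0 := by
      have h1 : (fun y => ∑ z ∈ s, χ z y) =ᶠ[𝓝 x] fun _ => 1 := by
        filter_upwards [K.isOpen.mem_nhds hx] with y hy using hsum y (subset_closure hy)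
      have h2 := h1.fderiv_eq (𝕜 := ℝ)
      rw [fderiv_fun_sum fun z hz => (hχ z hz).1.differentiable (by simp) x] at h2
      simp only [gradient]
      rw [← map_sum, h2]
      simp
    rw [Finset.sum_add_distrib, ← sum_inner, Finset.sum_add_distrib, ← Finset.sum_smul,
      ← Finset.smul_sum, hgr, ← Finset.sum_mul, ← Finset.sum_mul, hsum x (subset_closure hx)]
    simp [E', h', hx]
  · intro z hz
    obtain ⟨h1, h2, h3⟩ := hw.smul hh' hE' (hχ z hz).1 (hχ z hz).2.1
    exact (integrable_inner_of_memLp (h2.restrict _) hG).add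
      (integrable_mul_of_memLp (h1.restrict _) hd)

/-- Smooth fields are dense in `H(div; K)`. -/
theorem exists_smooth_approx {G : Plane → Plane} {d : Plane → ℝ}
    (hG : MemLp G 2 (volume.restrict K.carrier)) (hd : MemLp d 2 (volume.restrict K.carrier))
    (hGd : IsWeakDivergence K.carrier G d) :
    ∃ F : ℕ → Plane → Plane, (∀ k, ContDiff ℝ ∞ (F k)) ∧
      Tendsto (fun k => eLpNorm (F k - G) 2 (volume.restrict K.carrier)) atTop (𝓝 0) ∧
      Tendsto (fun k => eLpNorm (divergence (F k) - d) 2 (volume.restrict K.carrier))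
        atTop (𝓝 0) := by
  set μ := volume.restrict K.carrier with hμ
  have hFm : ∀ {F : Plane → Plane}, ContDiff ℝ ∞ F → MemLp F 2 μ := fun hF =>
    hF.continuous.memLp_carrier K 2
  have hDm : ∀ {F : Plane → Plane}, ContDiff ℝ ∞ F → MemLp (divergence F) 2 μ := fun hF =>
    (continuous_divergence (hF.of_le (by simp))).memLp_carrier K 2
  -- `S` is the graph of the divergence on smooth fields, inside the Hilbert space `L² × L²`, whose
  -- norm restricted to pairs `(G, div G)` is that of `H(div; K)`.
  let S : Submodule ℝ (WithLp 2 (Lp Plane 2 μ × Lp ℝ 2 μ)) :=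
    { carrier := {u | ∃ F, ContDiff ℝ ∞ F ∧ u.fst =ᵐ[μ] F ∧ u.snd =ᵐ[μ] divergence F}
      add_mem' := by
        rintro u v ⟨F, hF, h1, h2⟩ ⟨H, hH, h3, h4⟩
        refine ⟨F + H, hF.add hH, ?_, ?_⟩
        · exact (Lp.coeFn_add _ _).trans (h1.add h3)
        · refine (Lp.coeFn_add _ _).trans ?_
          filter_upwards [h2, h4] with x h5 h6
          change u.snd x + v.snd x = _
          rw [h5, h6, divergence_add (hF.differentiable (by simp) x)
            (hH.differentiable (by simp) x)]
      zero_mem' := by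
        refine ⟨0, contDiff_const, Lp.coeFn_zero _ _ _, ?_⟩
        refine (Lp.coeFn_zero _ _ _).trans (ae_of_all _ fun x => ?_)
        simp [divergence]
      smul_mem' := by
        rintro c u ⟨F, hF, h1, h2⟩
        refine ⟨c • F, contDiff_const.smul hF, ?_, ?_⟩
        · exact (Lp.coeFn_smul _ _).trans (h1.const_smul c)
        · refine (Lp.coeFn_smul _ _).trans ?_
          filter_upwards [h2] with x h5
          change c • u.snd x = _
          rw [h5]
          simp [divergence, fderiv_const_smul (hF.differentiable (by simp) x), mul_add] }
  set x : WithLp 2 (Lp Plane 2 μ × Lp ℝ 2 μ) := WithLp.toLp 2 (hG.toLp G, hd.toLp d) with hx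
  -- The double orthogonal complement is the closure of `S`, so it suffices to pair `(G, d)` with
  -- the pairs orthogonal to smooth fields.
  have hmem : x ∈ Sᗮᗮ := by
    rw [Submodule.mem_orthogonal]
    intro u hu
    rw [Submodule.mem_orthogonal'] at hu
    have hinner : ∀ (v : WithLp 2 (Lp Plane 2 μ × Lp ℝ 2 μ)) (F : Plane → Plane) (f : Plane → ℝ),
        v.fst =ᵐ[μ] F → v.snd =ᵐ[μ] f → ⟪u, v⟫ = ∫ x, (⟪u.fst x, F x⟫ + u.snd x * f x) ∂μ := by
      intro v F f h1 h2
      have h3 : ⟪u, v⟫ = ⟪u.fst, v.fst⟫ + ⟪u.snd, v.snd⟫ := WithLp.prod_inner_apply u v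
      rw [h3, L2.inner_def, L2.inner_def, ← integral_add
        (integrable_inner_of_memLp (Lp.memLp _) (Lp.memLp _))
        (integrable_inner_of_memLp (Lp.memLp _) (Lp.memLp _))]
      refine integral_congr_ae ?_
      filter_upwards [h1, h2] with y h4 h5
      rw [h4, h5]
      simp [mul_comm]
    rw [hinner x G d hG.coeFn_toLp hd.coeFn_toLp]
    refine K.integral_eq_zero_of_orthogonal (Lp.memLp _) (Lp.memLp _) (fun F hF => ?_) hG hd hGd
    rw [← hu (WithLp.toLp 2 ((hFm hF).toLp F, (hDm hF).toLp (divergence F)))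
      ⟨F, hF, (hFm hF).coeFn_toLp, (hDm hF).coeFn_toLp⟩]
    exact (hinner (WithLp.toLp 2 ((hFm hF).toLp F, (hDm hF).toLp (divergence F))) F (divergence F) (hFm hF).coeFn_toLp (hDm hF).coeFn_toLp).symm
  rw [Submodule.orthogonal_orthogonal_eq_closure, ← SetLike.mem_coe,
    Submodule.topologicalClosure_coe, mem_closure_iff_seq_limit] at hmem
  obtain ⟨u, hu, hux⟩ := hmem
  choose F hF h1 h2 using hu
  have hfst : Tendsto (fun k => (u k).fst) atTop (𝓝 x.fst) :=
    ((WithLp.prod_continuous_ofLp 2 _ _).fst.tendsto x).comp hux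
  have hsnd : Tendsto (fun k => (u k).snd) atTop (𝓝 x.snd) :=
    ((WithLp.prod_continuous_ofLp 2 _ _).snd.tendsto x).comp hux
  rw [Lp.tendsto_Lp_iff_tendsto_eLpNorm'] at hfst hsnd
  refine ⟨F, hF, hfst.congr fun k => eLpNorm_congr_ae ?_, hsnd.congr fun k => eLpNorm_congr_ae ?_⟩
  · exact (h1 k).sub hG.coeFn_toLp
  · exact (h2 k).sub hd.coeFn_toLp

end CurvilinearPolygon

/-! ### Convergence and norms in `L²` -/

section L2

variable {α : Type*} [MeasurableSpace α] {μ : Measure α} {W : Type*} [NormedAddCommGroup W]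
  [InnerProductSpace ℝ W]

theorem tendsto_integral_inner {f : ℕ → α → W} {f₀ g : α → W} (hf : ∀ k, MemLp (f k) 2 μ)
    (hf₀ : MemLp f₀ 2 μ) (hg : MemLp g 2 μ)
    (h : Tendsto (fun k => eLpNorm (f k - f₀) 2 μ) atTop (𝓝 0)) :
    Tendsto (fun k => ∫ x, ⟪f k x, g x⟫ ∂μ) atTop (𝓝 (∫ x, ⟪f₀ x, g x⟫ ∂μ)) := by
  have heq : ∀ {u : α → W} (hu : MemLp u 2 μ), ∫ x, ⟪u x, g x⟫ ∂μ = ⟪hu.toLp u, hg.toLp g⟫ := by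
    intro u hu
    rw [L2.inner_def]
    refine integral_congr_ae ?_
    filter_upwards [hu.coeFn_toLp, hg.coeFn_toLp] with x h1 h2
    rw [h1, h2]
  simp_rw [heq (hf _), heq hf₀]
  exact ((Lp.tendsto_Lp_iff_tendsto_eLpNorm'' f hf f₀ hf₀).2 h).inner tendsto_const_nhds

theorem tendsto_integral_mul {f : ℕ → α → ℝ} {f₀ g : α → ℝ} (hf : ∀ k, MemLp (f k) 2 μ)
    (hf₀ : MemLp f₀ 2 μ) (hg : MemLp g 2 μ)
    (h : Tendsto (fun k => eLpNorm (f k - f₀) 2 μ) atTop (𝓝 0)) :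
    Tendsto (fun k => ∫ x, f k x * g x ∂μ) atTop (𝓝 (∫ x, f₀ x * g x ∂μ)) := by
  simpa [mul_comm] using tendsto_integral_inner hf hf₀ hg h

theorem toReal_eLpNorm_two {f : α → W} (hf : MemLp f 2 μ) :
    (eLpNorm f 2 μ).toReal = Real.sqrt (∫ x, ‖f x‖ ^ 2 ∂μ) := by
  rw [← Lp.norm_toLp f hf, ← Real.sqrt_sq (norm_nonneg _), ← real_inner_self_eq_norm_sq,
    L2.inner_def]
  congr 1
  refine integral_congr_ae ?_
  filter_upwards [hf.coeFn_toLp] with x h1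
  rw [h1, real_inner_self_eq_norm_sq]

theorem abs_integral_inner_le {f g : α → W} (hf : MemLp f 2 μ) (hg : MemLp g 2 μ) :
    |∫ x, ⟪f x, g x⟫ ∂μ| ≤ (eLpNorm f 2 μ).toReal * (eLpNorm g 2 μ).toReal := by
  rw [← Lp.norm_toLp f hf, ← Lp.norm_toLp g hg]
  refine le_trans (le_of_eq ?_) (abs_real_inner_le_norm (hf.toLp f) (hg.toLp g))
  rw [L2.inner_def]
  congr 1
  refine integral_congr_ae ?_
  filter_upwards [hf.coeFn_toLp, hg.coeFn_toLp] with x h1 h2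
  rw [h1, h2]

theorem abs_integral_mul_le {f g : α → ℝ} (hf : MemLp f 2 μ) (hg : MemLp g 2 μ) :
    |∫ x, f x * g x ∂μ| ≤ (eLpNorm f 2 μ).toReal * (eLpNorm g 2 μ).toReal := by
  simpa [mul_comm] using abs_integral_inner_le hf hg

end L2

theorem tendsto_toReal_eLpNorm {α : Type*} [MeasurableSpace α] {μ : Measure α} {W : Type*}
    [NormedAddCommGroup W] {f : ℕ → α → W} {f₀ : α → W} (hf : ∀ k, MemLp (f k) 2 μ)
    (hf₀ : MemLp f₀ 2 μ) (h : Tendsto (fun k => eLpNorm (f k - f₀) 2 μ) atTop (𝓝 0)) :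
    Tendsto (fun k => (eLpNorm (f k) 2 μ).toReal) atTop (𝓝 (eLpNorm f₀ 2 μ).toReal) := by
  simp_rw [← Lp.norm_toLp _ (hf _), ← Lp.norm_toLp _ hf₀]
  exact ((Lp.tendsto_Lp_iff_tendsto_eLpNorm'' f hf f₀ hf₀).2 h).norm

/-! ### Uniqueness of weak derivatives, smooth functions -/

theorem MemH1.isWeakGradient {Ω : Set Plane} {v : Plane → ℝ} (hv : MemH1 Ω v) :
    IsWeakGradient Ω v (weakGradient Ω v) := by
  rw [weakGradient, dif_pos hv.2]; exact hv.2.choose_spec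

theorem MemH1.memLp_weakGradient {Ω : Set Plane} {v : Plane → ℝ} (hv : MemH1 Ω v) :
    MemLp (weakGradient Ω v) 2 (volume.restrict Ω) := hv.isWeakGradient.1

theorem IsTestFunction.continuous_gradient {Ω : Set Plane} {φ : Plane → ℝ}
    (hφ : IsTestFunction Ω φ) : Continuous (gradient φ) := hφ.1.gradient.continuous

namespace CurvilinearPolygon

variable (K : CurvilinearPolygon)

instance isFiniteMeasure_carrier : IsFiniteMeasure (volume.restrict K.carrier) :=
  ⟨by rw [Measure.restrict_apply_univ]; exact K.isBounded.measure_lt_top⟩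

theorem ae_eq_zero_of_integral_testFunction {W : Type*} [NormedAddCommGroup W] [NormedSpace ℝ W]
    [CompleteSpace W] {f : Plane → W} (hf : MemLp f 2 (volume.restrict K.carrier))
    (h : ∀ φ, IsTestFunction K.carrier φ → ∫ x in K.carrier, φ x • f x = 0) :
    f =ᵐ[volume.restrict K.carrier] 0 := by
  refine (ae_restrict_iff' K.isOpen.measurableSet).2 ?_
  have hi : IntegrableOn f K.carrier := hf.integrable one_le_two
  refine K.isOpen.ae_eq_zero_of_integral_contDiff_smul_eq_zero hi.locallyIntegrableOn
    fun φ h1 h2 h3 => ?_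
  rw [← h φ ⟨h1, h2, h3⟩]
  refine (setIntegral_eq_integral_of_forall_compl_eq_zero fun x hx => ?_).symm
  rw [image_eq_zero_of_notMem_tsupport fun h' => hx (h3 h'), zero_smul]

theorem integrable_testFunction_smul {W : Type*} [NormedAddCommGroup W] [NormedSpace ℝ W]
    {φ : Plane → ℝ} (hφ : Continuous φ) {f : Plane → W}
    (hf : MemLp f 2 (volume.restrict K.carrier)) :
    Integrable (fun x => φ x • f x) (volume.restrict K.carrier) := by
  obtain ⟨C, hC⟩ := K.isCompact_closure.exists_bound_of_continuousOn hφ.continuousOn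
  refine ((hf.integrable one_le_two).norm.const_mul C).mono'
    (hφ.aestronglyMeasurable.smul hf.aestronglyMeasurable) ?_
  refine (ae_restrict_mem K.isOpen.measurableSet).mono fun x hx => ?_
  rw [norm_smul]
  exact mul_le_mul_of_nonneg_right (hC x (subset_closure hx)) (norm_nonneg _)

variable {K}

theorem weakGradient_ae_eq {v : Plane → ℝ} {G : Plane → Plane}
    (hG : IsWeakGradient K.carrier v G) :
    weakGradient K.carrier v =ᵐ[volume.restrict K.carrier] G := by
  have hex : ∃ G, IsWeakGradient K.carrier v G := ⟨G, hG⟩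
  have hG' : IsWeakGradient K.carrier v (weakGradient K.carrier v) := by
    rw [weakGradient, dif_pos hex]; exact hex.choose_spec
  rw [← sub_ae_eq_zero]
  refine K.ae_eq_zero_of_integral_testFunction (hG'.1.sub hG.1) fun φ hφ => ?_
  simp only [Pi.sub_apply, smul_sub]
  rw [integral_sub (K.integrable_testFunction_smul hφ.1.continuous hG'.1)
    (K.integrable_testFunction_smul hφ.1.continuous hG.1), sub_eq_zero, ← neg_inj, ← hG'.2 φ hφ,
    ← hG.2 φ hφ]

theorem weakLaplacian_ae_eq {v d d' : Plane → ℝ} (hd : HasWeakLaplacian K.carrier v d)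
    (hd' : HasWeakLaplacian K.carrier v d') : d =ᵐ[volume.restrict K.carrier] d' := by
  rw [← sub_ae_eq_zero]
  refine K.ae_eq_zero_of_integral_testFunction (hd.1.sub hd'.1) fun φ hφ => ?_
  simp only [Pi.sub_apply, smul_sub]
  rw [integral_sub (K.integrable_testFunction_smul hφ.1.continuous hd.1)
    (K.integrable_testFunction_smul hφ.1.continuous hd'.1), sub_eq_zero, ← neg_inj]
  have h1 := (hd.2 φ hφ).symm.trans (hd'.2 φ hφ)
  simpa [mul_comm] using h1

theorem isWeakDivergence_divergence {F : Plane → Plane} (hF : ContDiff ℝ ∞ F) :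
    IsWeakDivergence K.carrier F (divergence F) := by
  intro φ hφ
  have h1 := K.integral_divergence_of_tsupport_subset ((hφ.1.smul hF).of_le (by simp))
    hφ.2.1.smul_right ((tsupport_smul_subset_left φ F).trans hφ.2.2)
  have h2 : ∀ x, divergence (φ • F) x = divergence F x * φ x + ⟪F x, gradient φ x⟫ := fun x => by
    rw [mul_comm]
    exact divergence_smul (hφ.1.differentiable (by simp) x) (hF.differentiable (by simp) x)
  have h3 : Continuous (divergence F) := continuous_divergence (hF.of_le (by simp))
  simp_rw [h2] at h1
  rw [integral_add (K.integrableOn_of_continuous (h3.fun_mul hφ.1.continuous))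
    (K.integrableOn_of_continuous (hF.continuous.inner hφ.continuous_gradient))] at h1
  linarith

theorem isWeakGradient_gradient {φ : Plane → ℝ} (hφ : ContDiff ℝ ∞ φ) :
    IsWeakGradient K.carrier φ (gradient φ) := by
  refine ⟨hφ.gradient.continuous.memLp_carrier K 2, fun θ hθ => ?_⟩
  have hi1 : IntegrableOn (fun x => φ x • gradient θ x) K.carrier :=
    K.integrableOn_of_continuous (hφ.continuous.smul hθ.continuous_gradient)
  have hi2 : IntegrableOn (fun x => θ x • gradient φ x) K.carrier :=
    K.integrableOn_of_continuous (hθ.1.continuous.smul hφ.gradient.continuous)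
  -- Pairing with a constant vector `v` reduces the vector identity to the weak divergence of the
  -- field `φ v`.
  refine ext_inner_left ℝ fun v => ?_
  rw [inner_neg_right, ← integral_inner hi1, ← integral_inner hi2]
  have h1 := isWeakDivergence_divergence (K := K) (F := fun x => φ x • v)
    (hφ.smul contDiff_const) θ hθ
  simp_rw [divergence_smul_const (hφ.differentiable (by simp) _), ← inner_gradient,
    real_inner_smul_left] at h1
  simpa [real_inner_smul_right, mul_comm] using h1

theorem memH1_of_contDiff {φ : Plane → ℝ} (hφ : ContDiff ℝ ∞ φ) : MemH1 K.carrier φ :=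
  ⟨hφ.continuous.memLp_carrier K 2, _, isWeakGradient_gradient hφ⟩

theorem weakGradient_of_contDiff {φ : Plane → ℝ} (hφ : ContDiff ℝ ∞ φ) :
    weakGradient K.carrier φ =ᵐ[volume.restrict K.carrier] gradient φ :=
  weakGradient_ae_eq (isWeakGradient_gradient hφ)

theorem hasTrace_of_contDiff {φ : Plane → ℝ} (hφ : ContDiff ℝ ∞ φ) : HasTrace K φ φ := by
  refine ⟨hφ.continuous.memLp_ds K 2, fun _ => φ, fun _ => hφ, by simp, ?_, by simp⟩
  have h : eLpNorm (gradient φ - weakGradient K.carrier φ) 2 (volume.restrict K.carrier) = 0 := by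
    rw [eLpNorm_congr_ae ((sub_ae_eq_zero _ _).2 (weakGradient_of_contDiff hφ).symm), eLpNorm_zero]
  simp [h]

theorem hasWeakLaplacian_of_contDiff {φ : Plane → ℝ} (hφ : ContDiff ℝ ∞ φ) :
    HasWeakLaplacian K.carrier φ (divergence (gradient φ)) := by
  refine ⟨(continuous_divergence (hφ.gradient.of_le (by simp))).memLp_carrier K 2,
    fun θ hθ => ?_⟩
  rw [← isWeakDivergence_divergence hφ.gradient θ hθ]
  refine integral_congr_ae ?_
  filter_upwards [weakGradient_of_contDiff (K := K) hφ] with x hx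
  rw [hx]

theorem _root_.MemH1.sub_contDiff {v : Plane → ℝ} (hv : MemH1 K.carrier v) {φ : Plane → ℝ}
    (hφ : ContDiff ℝ ∞ φ) : MemH1 K.carrier (v - φ) ∧
      weakGradient K.carrier (v - φ) =ᵐ[volume.restrict K.carrier]
        weakGradient K.carrier v - gradient φ := by
  have h : IsWeakGradient K.carrier (v - φ) (weakGradient K.carrier v - gradient φ) := by
    have hg := isWeakGradient_gradient (K := K) hφ
    refine ⟨hv.memLp_weakGradient.sub hg.1, fun θ hθ => ?_⟩
    have e1 : ∀ x, (v - φ) x • gradient θ x = v x • gradient θ x - φ x • gradient θ x := fun x =>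
      sub_smul _ _ _
    have e2 : ∀ x, θ x • (weakGradient K.carrier v - gradient φ) x =
        θ x • weakGradient K.carrier v x - θ x • gradient φ x := fun x => smul_sub _ _ _
    simp_rw [e1, e2]
    have hi : Integrable (fun x => v x • gradient θ x) (volume.restrict K.carrier) := by
      obtain ⟨C, hC⟩ := K.isCompact_closure.exists_bound_of_continuousOn
        hθ.continuous_gradient.continuousOn
      refine ((hv.1.integrable one_le_two).norm.mul_const C).mono'
        (hv.1.aestronglyMeasurable.smul hθ.continuous_gradient.aestronglyMeasurable) ?_
      refine (ae_restrict_mem K.isOpen.measurableSet).mono fun x hx => ?_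
      rw [norm_smul]
      exact mul_le_mul_of_nonneg_left (hC x (subset_closure hx)) (norm_nonneg _)
    rw [integral_sub hi (K.integrableOn_of_continuous
        (hφ.continuous.fun_smul hθ.continuous_gradient)),
      integral_sub (K.integrable_testFunction_smul hθ.1.continuous hv.memLp_weakGradient)
        (K.integrable_testFunction_smul hθ.1.continuous hg.1), hv.isWeakGradient.2 θ hθ,
      hg.2 θ hθ]
    abel
  exact ⟨⟨hv.1.sub (hφ.continuous.memLp_carrier K 2), _, h⟩, weakGradient_ae_eq h⟩

theorem hasWeakLaplacian_sub_contDiff {v d : Plane → ℝ} (hv : MemH1 K.carrier v)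
    (hd : HasWeakLaplacian K.carrier v d) {φ : Plane → ℝ} (hφ : ContDiff ℝ ∞ φ) :
    HasWeakLaplacian K.carrier (v - φ) (d - divergence (gradient φ)) := by
  have hg := isWeakDivergence_divergence (K := K) hφ.gradient
  have hdc : Continuous (divergence (gradient φ)) :=
    continuous_divergence (hφ.gradient.of_le (by simp))
  refine ⟨hd.1.sub (hdc.memLp_carrier K 2), fun θ hθ => ?_⟩
  have hgm : MemLp (gradient θ) 2 (volume.restrict K.carrier) :=
    hθ.continuous_gradient.memLp_carrier K 2
  have hθm : MemLp θ 2 (volume.restrict K.carrier) := hθ.1.continuous.memLp_carrier K 2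
  have h1 : ∫ x in K.carrier, ⟪weakGradient K.carrier (v - φ) x, gradient θ x⟫ =
      ∫ x in K.carrier, (⟪weakGradient K.carrier v x, gradient θ x⟫ -
        ⟪gradient φ x, gradient θ x⟫) := by
    refine integral_congr_ae ?_
    filter_upwards [(hv.sub_contDiff hφ).2] with x hx
    rw [hx, Pi.sub_apply, inner_sub_left]
  have e2 : ∀ x, (d - divergence (gradient φ)) x * θ x =
      d x * θ x - divergence (gradient φ) x * θ x := fun x => sub_mul _ _ _
  simp_rw [h1, e2]
  rw [integral_sub (integrable_inner_of_memLp hv.memLp_weakGradient hgm)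
      (integrable_inner_of_memLp (hφ.gradient.continuous.memLp_carrier K 2) hgm),
    integral_sub (integrable_mul_of_memLp hd.1 hθm)
      (integrable_mul_of_memLp (hdc.memLp_carrier K 2) hθm), hd.2 θ hθ, hg θ hθ]
  ring

theorem _root_.HasTrace.sub_contDiff {v f : Plane → ℝ} (hv : MemH1 K.carrier v)
    (hf : HasTrace K v f) {φ : Plane → ℝ} (hφ : ContDiff ℝ ∞ φ) :
    HasTrace K (v - φ) (f - φ) := by
  obtain ⟨hfm, ψ, h1, h2, h3, h4⟩ := hf
  refine ⟨hfm.sub (hφ.continuous.memLp_ds K 2), fun k => ψ k - φ, fun k => (h1 k).sub hφ, ?_, ?_, ?_⟩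
  · simpa using h2
  · refine h3.congr fun k => eLpNorm_congr_ae ?_
    filter_upwards [(hv.sub_contDiff hφ).2] with x hx
    have hgr : gradient (ψ k - φ) x = gradient (ψ k) x - gradient φ x := by
      simp only [gradient]
      rw [fderiv_sub ((h1 k).differentiable (by simp) x) (hφ.differentiable (by simp) x), map_sub]
    rw [Pi.sub_apply, Pi.sub_apply, hx, hgr, Pi.sub_apply]
    abel
  · simpa using h4

/-! ### Green's formula -/

theorem green_of_contDiff {F : Plane → Plane} (hF : ContDiff ℝ ∞ F) {φ : Plane → ℝ}
    (hφ : ContDiff ℝ ∞ φ) :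
    (∫ x in K.carrier, ⟪F x, gradient φ x⟫) + ∫ x in K.carrier, divergence F x * φ x =
      ∫ x, ⟪F x, outwardNormal K.carrier x⟫ * φ x ∂K.ds := by
  have h1 := K.integral_divergence ((hφ.smul hF).of_le (by simp))
  have h2 : ∀ x, divergence (φ • F) x = divergence F x * φ x + ⟪F x, gradient φ x⟫ := fun x => by
    rw [mul_comm]
    exact divergence_smul (hφ.differentiable (by simp) x) (hF.differentiable (by simp) x)
  have h3 : Continuous (divergence F) := continuous_divergence (hF.of_le (by simp))
  have h4 : ∀ x, ⟪(φ • F) x, outwardNormal K.carrier x⟫ =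
      ⟪F x, outwardNormal K.carrier x⟫ * φ x := fun x => by
    rw [Pi.smul_apply', real_inner_smul_left, mul_comm]
  simp_rw [h2, h4] at h1
  rw [integral_add (K.integrableOn_of_continuous (h3.fun_mul hφ.continuous))
    (K.integrableOn_of_continuous (hF.continuous.inner hφ.gradient.continuous))] at h1
  linarith

/-- With `F` fixed, all three terms are continuous in the convergences that define a trace, so the
formula passes from smooth functions to `w`. -/
theorem green {F : Plane → Plane} (hF : ContDiff ℝ ∞ F) {w f : Plane → ℝ}
    (hw : MemH1 K.carrier w) (hf : HasTrace K w f) :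
    (∫ x in K.carrier, ⟪F x, weakGradient K.carrier w x⟫) +
        ∫ x in K.carrier, divergence F x * w x =
      ∫ x, ⟪F x, outwardNormal K.carrier x⟫ * f x ∂K.ds := by
  obtain ⟨hfm, φ, h1, h2, h3, h4⟩ := hf
  have hFm : MemLp F 2 (volume.restrict K.carrier) := hF.continuous.memLp_carrier K 2
  have hDm : MemLp (divergence F) 2 (volume.restrict K.carrier) :=
    (continuous_divergence (hF.of_le (by simp))).memLp_carrier K 2
  have l1 := tendsto_integral_inner (fun k => (h1 k).gradient.continuous.memLp_carrier K 2)
    hw.memLp_weakGradient hFm h3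
  have l2 := tendsto_integral_mul (fun k => (h1 k).continuous.memLp_carrier K 2) hw.1 hDm h2
  have l3 := tendsto_integral_mul (fun k => (h1 k).continuous.memLp_ds K 2) hfm
    (K.memLp_inner_outwardNormal hF.continuous 2) h4
  simp_rw [real_inner_comm (F _)] at l1
  simp_rw [mul_comm _ (divergence F _)] at l2
  simp_rw [mul_comm _ ⟪F _, outwardNormal K.carrier _⟫] at l3
  refine tendsto_nhds_unique (l1.add l2) (l3.congr fun k => ?_)
  exact (green_of_contDiff hF (h1 k)).symm

end CurvilinearPolygon

/-! ### The normal derivative -/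

namespace CurvilinearPolygon

variable {K : CurvilinearPolygon}

theorem memLp_divergence {F : Plane → Plane} (hF : ContDiff ℝ ∞ F) :
    MemLp (divergence F) 2 (volume.restrict K.carrier) :=
  (continuous_divergence (hF.of_le (by simp))).memLp_carrier K 2

/-- The boundary integrals see only `f`, whereas the limit is written with `w`. Uniqueness of limits
therefore shows that the volume expression depends on `w` only through its trace. -/
theorem tendsto_boundary_integral {v d : Plane → ℝ} (hv : MemH1 K.carrier v)
    (hd : MemLp d 2 (volume.restrict K.carrier)) {F : ℕ → Plane → Plane}
    (hF : ∀ k, ContDiff ℝ ∞ (F k))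
    (h1 : Tendsto (fun k => eLpNorm (F k - weakGradient K.carrier v) 2
      (volume.restrict K.carrier)) atTop (𝓝 0))
    (h2 : Tendsto (fun k => eLpNorm (divergence (F k) - d) 2 (volume.restrict K.carrier))
      atTop (𝓝 0)) {w f : Plane → ℝ} (hw : MemH1 K.carrier w) (hf : HasTrace K w f) :
    Tendsto (fun k => ∫ x, ⟪F k x, outwardNormal K.carrier x⟫ * f x ∂K.ds) atTop
      (𝓝 ((∫ x in K.carrier, ⟪weakGradient K.carrier v x, weakGradient K.carrier w x⟫) +
        ∫ x in K.carrier, d x * w x)) := by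
  have l1 := tendsto_integral_inner (fun k => (hF k).continuous.memLp_carrier K 2)
    hv.memLp_weakGradient hw.memLp_weakGradient h1
  have l2 := tendsto_integral_mul (fun k => memLp_divergence (hF k)) hd hw.1 h2
  exact (l1.add l2).congr fun k => green (hF k) hw hf

/-- Any approximating fields and any choice of weak Laplacian lead to the same limit, so the value
at a trace does not depend on the chosen normal derivative. -/
theorem _root_.IsNormalDerivative.apply_eq {v d : Plane → ℝ} {ℓ : (Plane → ℝ) → ℝ}
    (hℓ : IsNormalDerivative K v ℓ) (hv : MemH1 K.carrier v)
    (hd : HasWeakLaplacian K.carrier v d) {w f : Plane → ℝ} (hw : MemH1 K.carrier w)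
    (hf : HasTrace K w f) :
    ℓ f = (∫ x in K.carrier, ⟪weakGradient K.carrier v x, weakGradient K.carrier w x⟫) +
      ∫ x in K.carrier, d x * w x := by
  obtain ⟨d', F, hd', hF, h1, h2, h3⟩ := hℓ
  have hdd : ∫ x in K.carrier, d x * w x = ∫ x in K.carrier, d' x * w x := by
    refine integral_congr_ae ?_
    filter_upwards [weakLaplacian_ae_eq hd hd'] with x hx
    rw [hx]
  rw [hdd]
  refine tendsto_nhds_unique ?_ (tendsto_boundary_integral hv hd'.1 hF h1 h2 hw hf)
  rw [Metric.tendsto_nhds]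
  intro ε hε
  -- Adding one keeps the divisor positive when the norm of `w` is zero.
  have hpos : 0 < h1Norm K.carrier w + 1 := add_pos_of_nonneg_of_pos (Real.sqrt_nonneg _) one_pos
  filter_upwards [h3 (ε / (h1Norm K.carrier w + 1)) (by positivity)] with k hk
  refine (hk w f hw hf).trans_lt ?_
  rw [div_mul_eq_mul_div, div_lt_iff₀ hpos]
  exact mul_lt_mul_of_pos_left (lt_add_one _) hε

theorem h1Norm_sq {w : Plane → ℝ} (hw : MemH1 K.carrier w) :
    (eLpNorm w 2 (volume.restrict K.carrier)).toReal ^ 2 +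
      (eLpNorm (weakGradient K.carrier w) 2 (volume.restrict K.carrier)).toReal ^ 2 =
      h1Norm K.carrier w ^ 2 := by
  have h1 : 0 ≤ ∫ x in K.carrier, w x ^ 2 := integral_nonneg fun x => sq_nonneg _
  have h2 : 0 ≤ ∫ x in K.carrier, ‖weakGradient K.carrier w x‖ ^ 2 :=
    integral_nonneg fun x => sq_nonneg _
  rw [toReal_eLpNorm_two hw.1, toReal_eLpNorm_two hw.memLp_weakGradient, h1Norm,
    Real.sq_sqrt (add_nonneg h1 h2), Real.sq_sqrt h2]
  simp only [Real.norm_eq_abs, sq_abs]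
  rw [Real.sq_sqrt h1]

/-- The volume expression defines the functional, and Cauchy–Schwarz bounds its distance to the
approximating fluxes by the `H(div)` error times the `H¹` norm of `w`, uniformly in `w`. -/
theorem exists_isNormalDerivative {v d : Plane → ℝ} (hv : MemH1 K.carrier v)
    (hd : HasWeakLaplacian K.carrier v d) : ∃ ℓ, IsNormalDerivative K v ℓ := by
  classical
  obtain ⟨F, hF, h1, h2⟩ := K.exists_smooth_approx hv.memLp_weakGradient hd.1 hd.2
  -- The extension `w` of `f` is chosen arbitrarily; the value `0` at functions that are not traces
  -- plays no role.
  let ℓ : (Plane → ℝ) → ℝ := fun f =>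
    if h : ∃ w, MemH1 K.carrier w ∧ HasTrace K w f then
      (∫ x in K.carrier, ⟪weakGradient K.carrier v x, weakGradient K.carrier h.choose x⟫) +
        ∫ x in K.carrier, d x * h.choose x else 0
  have hℓ : ∀ {w f}, MemH1 K.carrier w → HasTrace K w f → ℓ f =
      (∫ x in K.carrier, ⟪weakGradient K.carrier v x, weakGradient K.carrier w x⟫) +
        ∫ x in K.carrier, d x * w x := by
    intro w f hw hf
    have hex : ∃ w, MemH1 K.carrier w ∧ HasTrace K w f := ⟨w, hw, hf⟩
    simp only [ℓ, dif_pos hex]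
    exact tendsto_nhds_unique
      (tendsto_boundary_integral hv hd.1 hF h1 h2 hex.choose_spec.1 hex.choose_spec.2)
      (tendsto_boundary_integral hv hd.1 hF h1 h2 hw hf)
  refine ⟨ℓ, d, F, hd, hF, h1, h2, fun ε hε => ?_⟩
  have hFm : ∀ k, MemLp (F k) 2 (volume.restrict K.carrier) := fun k =>
    (hF k).continuous.memLp_carrier K 2
  have t1 := (ENNReal.tendsto_toReal ENNReal.zero_ne_top).comp h1
  have t2 := (ENNReal.tendsto_toReal ENNReal.zero_ne_top).comp h2
  have t3 := t1.add t2
  simp only [ENNReal.toReal_zero, add_zero] at t3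
  filter_upwards [t3.eventually_le_const hε] with k hk w f hw hf
  have hDm := memLp_divergence (K := K) (hF k)
  rw [← green (hF k) hw hf, hℓ hw hf]
  have e1 : (∫ x in K.carrier, ⟪F k x, weakGradient K.carrier w x⟫) -
      ∫ x in K.carrier, ⟪weakGradient K.carrier v x, weakGradient K.carrier w x⟫ =
      ∫ x in K.carrier, ⟪(F k - weakGradient K.carrier v) x, weakGradient K.carrier w x⟫ := by
    rw [← integral_sub (integrable_inner_of_memLp (hFm k) hw.memLp_weakGradient)
      (integrable_inner_of_memLp hv.memLp_weakGradient hw.memLp_weakGradient)]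
    simp only [Pi.sub_apply, inner_sub_left]
  have e2 : (∫ x in K.carrier, divergence (F k) x * w x) - ∫ x in K.carrier, d x * w x =
      ∫ x in K.carrier, (divergence (F k) - d) x * w x := by
    rw [← integral_sub (integrable_mul_of_memLp hDm hw.1) (integrable_mul_of_memLp hd.1 hw.1)]
    simp only [Pi.sub_apply, sub_mul]
  rw [add_sub_add_comm, e1, e2]
  have b1 := abs_integral_inner_le ((hFm k).sub hv.memLp_weakGradient) hw.memLp_weakGradient
  have b2 := abs_integral_mul_le (hDm.sub hd.1) hw.1
  have hn := h1Norm_sq hw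
  have hn0 : 0 ≤ h1Norm K.carrier w := Real.sqrt_nonneg _
  have c1 : (eLpNorm w 2 (volume.restrict K.carrier)).toReal ≤ h1Norm K.carrier w :=
    le_of_sq_le_sq (by nlinarith [sq_nonneg (eLpNorm (weakGradient K.carrier w) 2
      (volume.restrict K.carrier)).toReal]) hn0
  have c2 : (eLpNorm (weakGradient K.carrier w) 2 (volume.restrict K.carrier)).toReal ≤
      h1Norm K.carrier w :=
    le_of_sq_le_sq (by nlinarith [sq_nonneg (eLpNorm w 2
      (volume.restrict K.carrier)).toReal]) hn0
  simp only [Function.comp_apply] at hk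
  calc _ ≤ _ := abs_add_le _ _
    _ ≤ (eLpNorm (F k - weakGradient K.carrier v) 2 (volume.restrict K.carrier)).toReal *
          h1Norm K.carrier w +
        (eLpNorm (divergence (F k) - d) 2 (volume.restrict K.carrier)).toReal *
          h1Norm K.carrier w :=
      add_le_add (b1.trans (mul_le_mul_of_nonneg_left c2 ENNReal.toReal_nonneg))
        (b2.trans (mul_le_mul_of_nonneg_left c1 ENNReal.toReal_nonneg))
    _ ≤ ε * h1Norm K.carrier w := by
      rw [← add_mul]; exact mul_le_mul_of_nonneg_right hk hn0

theorem isNormalDerivative_normalDerivative {v d : Plane → ℝ} (hv : MemH1 K.carrier v)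
    (hd : HasWeakLaplacian K.carrier v d) : IsNormalDerivative K v (normalDerivative K v) := by
  have h := exists_isNormalDerivative hv hd
  rw [normalDerivative, dif_pos h]
  exact h.choose_spec

theorem normalDerivative_apply {v d : Plane → ℝ} (hv : MemH1 K.carrier v)
    (hd : HasWeakLaplacian K.carrier v d) {w f : Plane → ℝ} (hw : MemH1 K.carrier w)
    (hf : HasTrace K w f) :
    normalDerivative K v f =
      (∫ x in K.carrier, ⟪weakGradient K.carrier v x, weakGradient K.carrier w x⟫) +
      ∫ x in K.carrier, d x * w x :=
  (isNormalDerivative_normalDerivative hv hd).apply_eq hv hd hw hf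

theorem normalDerivative_apply_contDiff {v d : Plane → ℝ} (hv : MemH1 K.carrier v)
    (hd : HasWeakLaplacian K.carrier v d) {φ : Plane → ℝ} (hφ : ContDiff ℝ ∞ φ) :
    normalDerivative K v φ =
      (∫ x in K.carrier, ⟪weakGradient K.carrier v x, gradient φ x⟫) +
      ∫ x in K.carrier, d x * φ x := by
  rw [normalDerivative_apply hv hd (memH1_of_contDiff hφ) (hasTrace_of_contDiff hφ)]
  congr 1
  refine integral_congr_ae ?_
  filter_upwards [weakGradient_of_contDiff (K := K) hφ] with x hx
  rw [hx]

/-- The value of the normal derivative at the zero trace is computed twice, with `w` and with the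
zero function. -/
theorem integral_inner_of_trace_zero {v d : Plane → ℝ} (hv : MemH1 K.carrier v)
    (hd : HasWeakLaplacian K.carrier v d) {w : Plane → ℝ} (hw : MemH1 K.carrier w)
    (hf : HasTrace K w 0) :
    ∫ x in K.carrier, ⟪weakGradient K.carrier v x, weakGradient K.carrier w x⟫ =
      -∫ x in K.carrier, d x * w x := by
  have h1 := normalDerivative_apply hv hd hw hf
  have h2 := normalDerivative_apply_contDiff hv hd (φ := 0) contDiff_const
  have h3 : ∀ x, gradient (0 : Plane → ℝ) x = 0 := fun x => by simp [gradient]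
  simp only [h3, inner_zero_right, Pi.zero_apply, mul_zero, integral_zero, add_zero] at h2
  linarith

/-! ### Traces and normal derivatives represented by functions -/

/-- Green's formula with the fields `θ v`, for `v` a constant vector, determines the vector measure
`f n ds`; since `n` is a unit vector almost everywhere, this determines `f`. -/
theorem _root_.HasTrace.ae_eq {w f f' : Plane → ℝ} (hw : MemH1 K.carrier w) (hf : HasTrace K w f)
    (hf' : HasTrace K w f') : f =ᵐ[K.ds] f' := by
  have hfm : MemLp (f - f') 2 K.ds := hf.1.sub hf'.1
  have hn := K.aestronglyMeasurable_outwardNormal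
  have hi : Integrable (fun x => (f - f') x • outwardNormal K.carrier x) K.ds := by
    refine (hfm.integrable one_le_two).norm.mono' (hfm.aestronglyMeasurable.smul hn) ?_
    filter_upwards [K.ae_norm_outwardNormal] with x hx
    rw [norm_smul, hx, mul_one]
  have h0 : ∀ᵐ x ∂K.ds, (f - f') x • outwardNormal K.carrier x = 0 := by
    refine ae_eq_zero_of_integral_contDiff_smul_eq_zero hi.locallyIntegrable fun θ hθ _ => ?_
    have hθi : Integrable (fun x => θ x • ((f - f') x • outwardNormal K.carrier x)) K.ds := by
      obtain ⟨C, hC⟩ := K.isCompact_frontier.exists_bound_of_continuousOn hθ.continuous.continuousOn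
      refine (hi.norm.const_mul C).mono'
        (hθ.continuous.aestronglyMeasurable.smul hi.aestronglyMeasurable) ?_
      filter_upwards [K.ae_mem_frontier] with x hx
      rw [norm_smul]
      exact mul_le_mul_of_nonneg_right (hC x hx) (norm_nonneg _)
    refine ext_inner_left ℝ fun v => ?_
    rw [← integral_inner hθi, inner_zero_right]
    have hF : ContDiff ℝ ∞ fun x => θ x • v := hθ.smul contDiff_const
    have hFm := K.memLp_inner_outwardNormal hF.continuous 2
    have h1 := (green hF hw hf).symm.trans (green hF hw hf')
    rw [← sub_eq_zero, ← integral_sub (integrable_mul_of_memLp hFm hf.1)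
      (integrable_mul_of_memLp hFm hf'.1)] at h1
    rw [← h1]
    refine integral_congr_ae (ae_of_all _ fun x => ?_)
    simp only [Pi.sub_apply, real_inner_smul_left, real_inner_smul_right]
    ring
  filter_upwards [h0, K.ae_norm_outwardNormal] with x hx hnx
  have hne : outwardNormal K.carrier x ≠ 0 := fun h => by simp [h] at hnx
  exact sub_eq_zero.1 ((smul_eq_zero.1 hx).resolve_right hne)

/-- The function `t` times a bump equal to one on `[-M, M]` is smooth with compact support, hence
bounded and Lipschitz; one constant serves for both. -/
theorem exists_smooth_truncation (M : ℝ) : ∃ (T : ℝ → ℝ) (C : NNReal), ContDiff ℝ ∞ T ∧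
    LipschitzWith C T ∧ T 0 = 0 ∧ (∀ t, |T t| ≤ C) ∧ ∀ t, |t| ≤ M → T t = t := by
  let b : ContDiffBump (0 : ℝ) := ⟨|M| + 1, |M| + 2, by positivity, by linarith⟩
  have hT : ContDiff ℝ ∞ fun t => t * b t := contDiff_id.mul b.contDiff
  have hT' : HasCompactSupport fun t => t * b t := b.hasCompactSupport.mul_left
  obtain ⟨C, hC⟩ := hT.lipschitzWith_of_hasCompactSupport hT' (by simp)
  obtain ⟨D, hD⟩ := hT.continuous.bounded_above_of_compact_support hT'
  refine ⟨fun t => t * b t, max C D.toNNReal, hT, hC.weaken (le_max_left _ _), by simp,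
    fun t => ?_, fun t ht => ?_⟩
  · rw [NNReal.coe_max]
    exact (hD t).trans ((Real.le_coe_toNNReal D).trans (le_max_right _ _))
  · have : b t = 1 := b.one_of_mem_closedBall (by
      change t ∈ Metric.closedBall 0 (|M| + 1)
      rw [mem_closedBall_zero_iff, Real.norm_eq_abs]
      linarith [le_abs_self M])
    simp [this]

theorem norm_gradient_comp_le {T : ℝ → ℝ} {C : NNReal} (hT : ContDiff ℝ ∞ T)
    (hC : LipschitzWith C T) {φ : Plane → ℝ} (hφ : ContDiff ℝ ∞ φ) (x : Plane) :
    ‖gradient (T ∘ φ) x‖ ≤ C * ‖gradient φ x‖ := by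
  simp only [gradient, LinearIsometryEquiv.norm_map]
  rw [fderiv_comp x (hT.differentiable (by simp) _) (hφ.differentiable (by simp) x)]
  exact (ContinuousLinearMap.opNorm_comp_le _ _).trans
    (mul_le_mul_of_nonneg_right (norm_fderiv_le_of_lipschitz ℝ hC) (norm_nonneg _))

/-- The action of an integrable normal derivative on a bounded trace is the boundary integral. -/
theorem normalDerivative_eq_integral_of_bounded {v d g : Plane → ℝ} (hv : MemH1 K.carrier v)
    (hd : HasWeakLaplacian K.carrier v d) (hg : NormalDerivativeIsFunction K v g)
    {w f : Plane → ℝ} (hw : MemH1 K.carrier w) (hf : HasTrace K w f) {M : ℝ}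
    (hM : ∀ᵐ x ∂K.ds, |f x| ≤ M) :
    Integrable (fun x => g x * f x) K.ds ∧ normalDerivative K v f = ∫ x, g x * f x ∂K.ds := by
  obtain ⟨T, C, hT, hTC, hT0, hTb, hTM⟩ := exists_smooth_truncation M
  obtain ⟨hfm, φ, h1, h2, h3, h4⟩ := id hf
  have hψ : ∀ k, ContDiff ℝ ∞ (T ∘ φ k) := fun k => hT.comp (h1 k)
  have hTt : ∀ t, |T t| ≤ C * |t| := fun t => by
    simpa [hT0, Real.dist_eq] using hTC.dist_le_mul t 0
  have hfi : Integrable (fun x => g x * f x) K.ds := by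
    refine (hg.1.norm.mul_const M).mono' (hg.1.aestronglyMeasurable.mul hfm.aestronglyMeasurable) ?_
    filter_upwards [hM] with x hx
    rw [norm_mul]
    exact mul_le_mul_of_nonneg_left hx (norm_nonneg _)
  refine ⟨hfi, ?_⟩
  -- Since `T` fixes the values of `f`, its Lipschitz bound transfers the boundary convergence to
  -- the truncated functions.
  have hconv : Tendsto (fun k => eLpNorm (T ∘ φ k - f) 2 K.ds) atTop (𝓝 0) := by
    have hle : ∀ k, eLpNorm (T ∘ φ k - f) 2 K.ds ≤ C * eLpNorm (φ k - f) 2 K.ds := by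
      intro k
      refine eLpNorm_le_nnreal_smul_eLpNorm_of_ae_le_mul (c := C) ?_ 2
      filter_upwards [hM] with x hx
      have := hTC.dist_le_mul (φ k x) (f x)
      rw [hTM _ hx] at this
      rw [← NNReal.coe_le_coe]
      simpa [Real.dist_eq] using this
    have h0 : Tendsto (fun k => (C : ENNReal) * eLpNorm (φ k - f) 2 K.ds) atTop (𝓝 0) := by
      simpa using ENNReal.Tendsto.const_mul h4 (Or.inr ENNReal.coe_ne_top)
    exact tendsto_of_tendsto_of_tendsto_of_le_of_le tendsto_const_nhds h0 (fun _ => zero_le) hle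
  -- Convergence of `T ∘ φ k` in `H¹` is not needed: a uniform bound suffices, because normal
  -- derivatives are approximated uniformly on bounded sets of `H¹`.
  have hbdd : ∃ D, ∀ k, h1Norm K.carrier (T ∘ φ k) ≤ D := by
    have t1 := tendsto_toReal_eLpNorm (fun k => (h1 k).continuous.memLp_carrier K 2) hw.1 h2
    have t2 := tendsto_toReal_eLpNorm (fun k => (h1 k).gradient.continuous.memLp_carrier K 2)
      hw.memLp_weakGradient h3
    obtain ⟨D, hD⟩ := ((t1.add t2).const_mul (C : ℝ)).bddAbove_range
    refine ⟨D, fun k => le_trans ?_ (hD (mem_range_self k))⟩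
    have m1 : MemLp (φ k) 2 (volume.restrict K.carrier) := (h1 k).continuous.memLp_carrier K 2
    have m2 : MemLp (gradient (φ k)) 2 (volume.restrict K.carrier) :=
      (h1 k).gradient.continuous.memLp_carrier K 2
    have b1 : (eLpNorm (T ∘ φ k) 2 (volume.restrict K.carrier)).toReal ≤
        C * (eLpNorm (φ k) 2 (volume.restrict K.carrier)).toReal := by
      have := eLpNorm_le_nnreal_smul_eLpNorm_of_ae_le_mul (μ := volume.restrict K.carrier)
        (f := T ∘ φ k) (g := φ k) (c := C) (ae_of_all _ fun x => by
          rw [← NNReal.coe_le_coe]; simpa using hTt (φ k x)) 2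
      have h5 := ENNReal.toReal_mono (ENNReal.mul_ne_top ENNReal.coe_ne_top m1.2.ne) this
      simpa using h5
    have b2 : (eLpNorm (weakGradient K.carrier (T ∘ φ k)) 2
        (volume.restrict K.carrier)).toReal ≤
        C * (eLpNorm (gradient (φ k)) 2 (volume.restrict K.carrier)).toReal := by
      rw [eLpNorm_congr_ae (weakGradient_of_contDiff (hψ k))]
      have := eLpNorm_le_nnreal_smul_eLpNorm_of_ae_le_mul (μ := volume.restrict K.carrier)
        (f := gradient (T ∘ φ k)) (g := gradient (φ k)) (c := C) (ae_of_all _ fun x => by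
          rw [← NNReal.coe_le_coe]; simpa using norm_gradient_comp_le hT hTC (h1 k) x) 2
      have h5 := ENNReal.toReal_mono (ENNReal.mul_ne_top ENNReal.coe_ne_top m2.2.ne) this
      simpa using h5
    have hn := h1Norm_sq (memH1_of_contDiff (K := K) (hψ k))
    have p1 : 0 ≤ (eLpNorm (T ∘ φ k) 2 (volume.restrict K.carrier)).toReal :=
      ENNReal.toReal_nonneg
    have p2 : 0 ≤ (eLpNorm (weakGradient K.carrier (T ∘ φ k)) 2
      (volume.restrict K.carrier)).toReal := ENNReal.toReal_nonneg
    rw [mul_add]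
    refine le_trans (le_of_sq_le_sq ?_ (add_nonneg p1 p2)) (add_le_add b1 b2)
    rw [← hn]
    nlinarith [mul_nonneg p1 p2]
  obtain ⟨D, hD⟩ := hbdd
  have hD0 : 0 ≤ D := (Real.sqrt_nonneg _).trans (hD 0)
  -- One smooth field `F j` approximates the functional within `δ` times the `H¹` norm, at `f` and
  -- at all truncations. Its flux density is in `L²`, so boundary convergence handles the middle
  -- term.
  have hlim : Tendsto (fun k => normalDerivative K v (T ∘ φ k)) atTop
      (𝓝 (normalDerivative K v f)) := by
    obtain ⟨d', F, -, hF, -, -, hFe⟩ := isNormalDerivative_normalDerivative hv hd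
    rw [Metric.tendsto_atTop']
    intro ε hε
    have hw0 : 0 ≤ h1Norm K.carrier w := Real.sqrt_nonneg _
    set δ := ε / (2 * (D + h1Norm K.carrier w + 1)) with hδ
    have hδ0 : 0 < δ := by positivity
    have hδε : δ * (D + h1Norm K.carrier w) < ε / 2 := by
      have : δ * (D + h1Norm K.carrier w + 1) = ε / 2 := by rw [hδ]; field_simp
      nlinarith
    obtain ⟨j, hj⟩ := (hFe δ hδ0).exists
    have hl := tendsto_integral_mul (fun k => (hψ k).continuous.memLp_ds K 2) hfm
      (K.memLp_inner_outwardNormal (hF j).continuous 2) hconv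
    simp_rw [mul_comm _ ⟪F j _, outwardNormal K.carrier _⟫] at hl
    obtain ⟨N, hN⟩ := Metric.tendsto_atTop.1 hl (ε / 2) (by positivity)
    refine ⟨N, fun k hk => ?_⟩
    have a1 := hj _ _ (memH1_of_contDiff (hψ k)) (hasTrace_of_contDiff (hψ k))
    have a2 := hj _ _ hw hf
    have a3 := hN k hk.le
    rw [Real.dist_eq] at a3 ⊢
    have a4 := mul_le_mul_of_nonneg_left (hD k) hδ0.le
    rw [abs_le] at a1 a2
    rw [abs_lt] at a3 ⊢
    constructor <;> nlinarith
  -- On the side of `g`, which is only integrable, a subsequence converging almost everywhere is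
  -- dominated by `C |g|`.
  obtain ⟨ns, hns, hae⟩ := (tendstoInMeasure_of_tendsto_eLpNorm (by simp)
    (fun k => (hψ k).continuous.aestronglyMeasurable) hfm.aestronglyMeasurable
    hconv).exists_seq_tendsto_ae
  have hlim' := hlim.comp hns.tendsto_atTop
  refine tendsto_nhds_unique hlim' ?_
  have hrep : ∀ j, (fun k => normalDerivative K v (T ∘ φ k)) (ns j) =
      ∫ x, g x * (T ∘ φ (ns j)) x ∂K.ds := fun j => hg.2 _ (hψ _)
  refine Tendsto.congr (fun j => (hrep j).symm) ?_
  refine tendsto_integral_of_dominated_convergence (fun x => ‖g x‖ * C)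
    (fun j => hg.1.aestronglyMeasurable.mul (hψ _).continuous.aestronglyMeasurable)
    (hg.1.norm.mul_const _) (fun j => ae_of_all _ fun x => ?_) ?_
  · rw [norm_mul]
    exact mul_le_mul_of_nonneg_left (hTb _) (norm_nonneg _)
  · filter_upwards [hae] with x hx
    exact hx.const_mul _

end CurvilinearPolygon

/-! ### Polynomials -/

theorem contDiff_polyFun (p : MvPolynomial (Fin 2) ℝ) : ContDiff ℝ ∞ (polyFun p) := by
  induction p using MvPolynomial.induction_on with
  | C a =>
    have h : polyFun (MvPolynomial.C a) = fun _ => a := by ext x; simp [polyFun]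
    rw [h]; exact contDiff_const
  | add p q hp hq =>
    have h : polyFun (p + q) = fun x => polyFun p x + polyFun q x := by ext x; simp [polyFun]
    rw [h]; exact hp.add hq
  | mul_X p i hp =>
    have h : polyFun (p * MvPolynomial.X i) = fun x => polyFun p x * x i := by
      ext x; simp [polyFun]
    rw [h]; exact hp.mul (EuclideanSpace.proj (𝕜 := ℝ) i).contDiff

theorem fderiv_polyFun (p : MvPolynomial (Fin 2) ℝ) (j : Fin 2) (x : Plane) :
    fderiv ℝ (polyFun p) x (EuclideanSpace.single j 1) =
      polyFun (MvPolynomial.pderiv j p) x := by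
  induction p using MvPolynomial.induction_on with
  | C a =>
    have h : polyFun (MvPolynomial.C a) = fun _ => a := by ext x; simp [polyFun]
    rw [h]; simp [polyFun]
  | add p q hp hq =>
    have h : polyFun (p + q) = fun x => polyFun p x + polyFun q x := by ext x; simp [polyFun]
    rw [h, fderiv_fun_add ((contDiff_polyFun p).differentiable (by simp) x)
      ((contDiff_polyFun q).differentiable (by simp) x)]
    simp [hp, hq, polyFun]
  | mul_X p i hp =>
    have h : polyFun (p * MvPolynomial.X i) = fun x => polyFun p x * x i := by
      ext x; simp [polyFun]
    have hi : HasFDerivAt (fun x : Plane => x i) (EuclideanSpace.proj (𝕜 := ℝ) i) x :=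
      (EuclideanSpace.proj (𝕜 := ℝ) i).hasFDerivAt
    rw [h, fderiv_fun_mul ((contDiff_polyFun p).differentiable (by simp) x) hi.differentiableAt,
      hi.fderiv]
    rcases eq_or_ne i j with rfl | hij
    · simp [hp, polyFun]
    · simp [hp, polyFun, hij, MvPolynomial.pderiv_X_of_ne hij]

theorem divergence_gradient_polyFun (p : MvPolynomial (Fin 2) ℝ) :
    divergence (gradient (polyFun p)) = polyFun (polyLaplacian p) := by
  ext x
  have h : ∀ i, fderiv ℝ (gradient (polyFun p)) x (EuclideanSpace.single i 1) i =
      polyFun (MvPolynomial.pderiv i (MvPolynomial.pderiv i p)) x := by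
    intro i
    have h1 := (EuclideanSpace.proj (𝕜 := ℝ) i).hasFDerivAt.comp x
      ((contDiff_polyFun p).gradient.differentiable (by simp) x).hasFDerivAt
    have h2 : (EuclideanSpace.proj (𝕜 := ℝ) i : Plane → ℝ) ∘ gradient (polyFun p) =
        polyFun (MvPolynomial.pderiv i p) := by
      ext y
      exact (gradient_apply _ y i).trans (fderiv_polyFun p i y)
    rw [h2] at h1
    rw [← fderiv_polyFun, h1.fderiv]
    rfl
  simp only [divergence, h]
  simp [polyLaplacian, polyFun]

theorem neg_polyFun (p : MvPolynomial (Fin 2) ℝ) : -polyFun p = polyFun (-p) := by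
  ext x; simp [polyFun]

theorem neg_mem_polySpace {k : ℤ} {p : MvPolynomial (Fin 2) ℝ} (hp : p ∈ polySpace k) :
    -p ∈ polySpace k := fun h => by
  rw [MvPolynomial.totalDegree_neg]; exact hp (neg_ne_zero.1 h)

theorem polyFun_mem_polyStar (K : CurvilinearPolygon) {m : ℕ} {p : MvPolynomial (Fin 2) ℝ}
    (hp : p ∈ polySpace m) : polyFun p ∈ polyStar K m :=
  ⟨(contDiff_polyFun p).continuous.continuousOn, fun _ => ⟨p, hp, fun _ _ => rfl⟩⟩

/-! ### Green formulas for the local spaces -/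

namespace CurvilinearPolygon

variable {K : CurvilinearPolygon} {m : ℕ}

theorem hasWeakLaplacian_polyFun (p : MvPolynomial (Fin 2) ℝ) :
    HasWeakLaplacian K.carrier (polyFun p) (polyFun (polyLaplacian p)) :=
  divergence_gradient_polyFun p ▸ hasWeakLaplacian_of_contDiff (contDiff_polyFun p)

theorem hasWeakLaplacian_sub_polyFun {v : Plane → ℝ} {P : MvPolynomial (Fin 2) ℝ}
    (hv : MemH1 K.carrier v) (hvP : HasWeakLaplacian K.carrier v (polyFun (polyLaplacian P))) :
    HasWeakLaplacian K.carrier (v - polyFun P) 0 := by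
  have h := hasWeakLaplacian_sub_contDiff hv hvP (contDiff_polyFun P)
  rwa [divergence_gradient_polyFun, sub_self] at h

theorem hasTrace_sub_polyFun {v : Plane → ℝ} (hv : MemH1 K.carrier v) (hv0 : HasTrace K v 0)
    (P : MvPolynomial (Fin 2) ℝ) : HasTrace K (v - polyFun P) (-polyFun P) := by
  have h := hv0.sub_contDiff hv (contDiff_polyFun P)
  rwa [zero_sub] at h

theorem integral_inner_eq_zero {v w : Plane → ℝ} (hv : MemH1 K.carrier v)
    (hv0 : HasWeakLaplacian K.carrier v 0) (hw : MemH1 K.carrier w) (hw0 : HasTrace K w 0) :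
    ∫ x in K.carrier, ⟪weakGradient K.carrier v x, weakGradient K.carrier w x⟫ = 0 := by
  rw [integral_inner_of_trace_zero hv hv0 hw hw0]
  simp

theorem integral_inner_eq_normalDerivative {v w f : Plane → ℝ} (hv : MemH1 K.carrier v)
    (hv0 : HasWeakLaplacian K.carrier v 0) (hw : MemH1 K.carrier w) (hf : HasTrace K w f) :
    ∫ x in K.carrier, ⟪weakGradient K.carrier v x, weakGradient K.carrier w x⟫ =
      normalDerivative K v f := by
  rw [normalDerivative_apply hv hv0 hw hf]
  simp

/-- Write `w = (w - Q) + Q`. The first summand is harmonic and `v` has zero trace, so their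
gradients are orthogonal; the second is smooth, and Green's formula for `v` applies to it. -/
theorem integral_inner_eq_normalDerivative_sub {v w p : Plane → ℝ} {Q : MvPolynomial (Fin 2) ℝ}
    (hv : MemH1 K.carrier v) (hvp : HasWeakLaplacian K.carrier v p) (hv0 : HasTrace K v 0)
    (hw : MemH1 K.carrier w) (hwQ : HasWeakLaplacian K.carrier w (polyFun (polyLaplacian Q))) :
    ∫ x in K.carrier, ⟪weakGradient K.carrier v x, weakGradient K.carrier w x⟫ =
      normalDerivative K v (polyFun Q) - ∫ x in K.carrier, p x * polyFun Q x := by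
  have hQ := contDiff_polyFun Q
  rw [normalDerivative_apply_contDiff hv hvp hQ, add_sub_cancel_right, ← sub_eq_zero,
    ← integral_sub (integrable_inner_of_memLp hv.memLp_weakGradient hw.memLp_weakGradient)
      (integrable_inner_of_memLp hv.memLp_weakGradient (hQ.gradient.continuous.memLp_carrier K 2)),
    ← integral_inner_eq_zero (hw.sub_contDiff hQ).1 (hasWeakLaplacian_sub_polyFun hw hwQ) hv hv0]
  refine integral_congr_ae ?_
  filter_upwards [(hw.sub_contDiff hQ).2] with x hx
  rw [hx, real_inner_comm (weakGradient K.carrier v x), Pi.sub_apply, inner_sub_right]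

theorem exists_ae_bound_of_mem_polyStar {f : Plane → ℝ} (hf : f ∈ polyStar K m) :
    ∃ M, ∀ᵐ x ∂K.ds, |f x| ≤ M := by
  obtain ⟨M, hM⟩ := K.isCompact_frontier.exists_bound_of_continuousOn hf.1
  exact ⟨M, K.ae_mem_frontier.mono fun x hx => hM x hx⟩

/-- Additivity is claimed only at traces, where each functional is given by its volume expression;
elsewhere the chosen functionals are unconstrained. -/
theorem normalDerivative_eq_add {v d : Plane → ℝ} {P : MvPolynomial (Fin 2) ℝ}
    (hv : MemH1 K.carrier v) (hvP : HasWeakLaplacian K.carrier v d)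
    (hvP' : HasWeakLaplacian K.carrier (v - polyFun P) (d - polyFun (polyLaplacian P)))
    {u f : Plane → ℝ} (hu : MemH1 K.carrier u) (hf : HasTrace K u f) :
    normalDerivative K v f =
      normalDerivative K (v - polyFun P) f + normalDerivative K (polyFun P) f := by
  have hP := contDiff_polyFun P
  have hPL := hasWeakLaplacian_polyFun (K := K) P
  rw [normalDerivative_apply hv hvP hu hf, normalDerivative_apply (hv.sub_contDiff hP).1 hvP' hu hf,
    normalDerivative_apply (memH1_of_contDiff hP) hPL hu hf, add_add_add_comm,
    ← integral_add
      (integrable_inner_of_memLp (hv.sub_contDiff hP).1.memLp_weakGradient hu.memLp_weakGradient)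
      (integrable_inner_of_memLp (memH1_of_contDiff hP).memLp_weakGradient hu.memLp_weakGradient),
    ← integral_add (integrable_mul_of_memLp hvP'.1 hu.1) (integrable_mul_of_memLp hPL.1 hu.1)]
  congr 1
  · refine integral_congr_ae ?_
    filter_upwards [(hv.sub_contDiff hP).2, weakGradient_of_contDiff (K := K) hP] with x h1 h2
    rw [h1, h2, ← inner_add_left, Pi.sub_apply, sub_add_cancel]
  · refine integral_congr_ae (ae_of_all _ fun x => ?_)
    simp only [Pi.sub_apply]
    ring

theorem normalDerivative_of_contDiff {φ : Plane → ℝ} (hφ : ContDiff ℝ ∞ φ) {u f : Plane → ℝ}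
    (hu : MemH1 K.carrier u) (hf : HasTrace K u f) :
    normalDerivative K φ f = ∫ x, ⟪gradient φ x, outwardNormal K.carrier x⟫ * f x ∂K.ds := by
  rw [normalDerivative_apply (memH1_of_contDiff hφ) (hasWeakLaplacian_of_contDiff hφ) hu hf,
    ← green hφ.gradient hu hf]
  congr 1
  refine integral_congr_ae ?_
  filter_upwards [weakGradient_of_contDiff (K := K) hφ] with x hx
  rw [hx]

end CurvilinearPolygon

open CurvilinearPolygon in
theorem mainTheorem3 (K : CurvilinearPolygon) (m : ℕ) :
    -- first formula
    (∀ v ∈ boundarySpace K m, ∀ w ∈ interiorSpace K m,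
      ∫ x in K.carrier, ⟪weakGradient K.carrier v x, weakGradient K.carrier w x⟫ = 0) ∧
    -- second formula
    (∀ v ∈ boundarySpace K m, ∀ w ∈ boundarySpace K m, ∀ f, HasTrace K w f →
      IsNormalDerivative K v (normalDerivative K v) ∧
      ∫ x in K.carrier, ⟪weakGradient K.carrier v x, weakGradient K.carrier w x⟫ =
        normalDerivative K v f ∧
      ∀ g, NormalDerivativeIsFunction K v g →
        Integrable (fun x => g x * f x) K.ds ∧
        ∫ x in K.carrier, ⟪weakGradient K.carrier v x, weakGradient K.carrier w x⟫ =
          ∫ x, g x * f x ∂K.ds) ∧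
    -- third formula
    (∀ v ∈ interiorSpace K m, ∀ w ∈ interiorSpace K m,
      ∀ p ∈ polySpace ((m : ℤ) - 2), ∀ q ∈ polySpace ((m : ℤ) - 2),
      HasWeakLaplacian K.carrier v (polyFun p) → HasWeakLaplacian K.carrier w (polyFun q) →
      ∀ P ∈ polySpace m, ∀ Q ∈ polySpace m, polyLaplacian P = p → polyLaplacian Q = q →
      IsNormalDerivative K v (normalDerivative K v) ∧
      ∫ x in K.carrier, ⟪weakGradient K.carrier v x, weakGradient K.carrier w x⟫ =
        normalDerivative K v (polyFun Q) - ∫ x in K.carrier, polyFun p x * polyFun Q x ∧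
      (∀ g, NormalDerivativeIsFunction K v g →
        Integrable (fun x => g x * polyFun Q x) K.ds ∧
        ∫ x in K.carrier, ⟪weakGradient K.carrier v x, weakGradient K.carrier w x⟫ =
          ∫ x, g x * polyFun Q x ∂K.ds - ∫ x in K.carrier, polyFun p x * polyFun Q x) ∧
      -- the normal derivative of `v` from that of the harmonic function `v - P`
      v - polyFun P ∈ boundarySpace K m ∧ HasTrace K (v - polyFun P) (-polyFun P) ∧
      IsNormalDerivative K (v - polyFun P) (normalDerivative K (v - polyFun P)) ∧
      IsNormalDerivative K (polyFun P) (normalDerivative K (polyFun P)) ∧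
      ∀ u f, MemH1 K.carrier u → HasTrace K u f →
        normalDerivative K v f =
          normalDerivative K (v - polyFun P) f + normalDerivative K (polyFun P) f ∧
        normalDerivative K (polyFun P) f =
          ∫ x, ⟪gradient (polyFun P) x, outwardNormal K.carrier x⟫ * f x ∂K.ds) := by
  refine ⟨?_, ?_, ?_⟩
  · rintro v ⟨hv, hv0, -⟩ w ⟨hw, -, hw0⟩
    exact integral_inner_eq_zero hv hv0 hw hw0
  · rintro v ⟨hv, hv0, -⟩ w ⟨hw, -, f', hf', hwf'⟩ f hf
    have heq := integral_inner_eq_normalDerivative hv hv0 hw hf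
    refine ⟨isNormalDerivative_normalDerivative hv hv0, heq, fun g hg => ?_⟩
    obtain ⟨M, hM⟩ := exists_ae_bound_of_mem_polyStar hf'
    -- Here `f` is an arbitrary representative of the trace of `w`; uniqueness of traces gives it
    -- the bound of the piecewise polynomial one.
    have hM' : ∀ᵐ x ∂K.ds, |f x| ≤ M := by
      filter_upwards [hM, hf.ae_eq hw hwf'] with x h1 h2
      rwa [h2]
    obtain ⟨h1, h2⟩ := normalDerivative_eq_integral_of_bounded hv hv0 hg hw hf hM'
    exact ⟨h1, heq.trans h2⟩
  · rintro v ⟨hv, -, hv0⟩ w ⟨hw, -, -⟩ p - q - hvp hwq P hP Q - rfl rfl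
    have hPs := contDiff_polyFun P
    have hQs := contDiff_polyFun Q
    have heq := integral_inner_eq_normalDerivative_sub hv hvp hv0 hw hwq
    have hlap := hasWeakLaplacian_sub_polyFun hv hvp
    have hmem := (hv.sub_contDiff hPs).1
    have htr := hasTrace_sub_polyFun hv hv0 P
    refine ⟨isNormalDerivative_normalDerivative hv hvp, heq, fun g hg => ⟨?_, ?_⟩,
      ⟨hmem, hlap, -polyFun P, ?_, htr⟩, htr, isNormalDerivative_normalDerivative hmem hlap,
      isNormalDerivative_normalDerivative (memH1_of_contDiff hPs) (hasWeakLaplacian_polyFun P),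
      fun u f hu hf => ⟨normalDerivative_eq_add hv hvp (by rwa [sub_self]) hu hf,
        normalDerivative_of_contDiff hPs hu hf⟩⟩
    · obtain ⟨C, hC⟩ := K.isCompact_frontier.exists_bound_of_continuousOn
        hQs.continuous.continuousOn
      exact (normalDerivative_eq_integral_of_bounded hv hvp hg (memH1_of_contDiff hQs)
        (hasTrace_of_contDiff hQs) (M := C) (K.ae_mem_frontier.mono fun x hx => hC x hx)).1
    -- `Q` is smooth, so the representation by `g` applies to it directly.
    · rw [heq, hg.2 _ hQs]
    · rw [neg_polyFun]
      exact polyFun_mem_polyStar K (neg_mem_polySpace hP)
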